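/- **Setting.** Let $Z_1,Z_2,\dots$ be random elements of a measurable space, defined on a probability space with measure $\mathbb P$, and let $\mathcal F_s^k=\sigma(Z_s,\dots,Z_k)$ for $1\le s\le k\le\infty$. Let $$\phi_{\mathbf Z}(t)=\sup_{s\ge1}\ \sup\{|\mathbb P(A\mid B)-\mathbb P(A)|:\ A\in\mathcal F_{s+t}^\infty,\ B\in\mathcal F_1^s,\ \mathbb P(B)>0\}.$$ Let $Z$ have the law of $Z_1$, let $\Theta\subset\mathbb R^d$, let $l(z,\theta)$ be a loss function with $l(Z,\theta)$ integrable for every $\theta\in\Theta$, and put $L(\theta)=\mathbb E[l(Z,\theta)]$. Let $\nabla l(z,\theta)$ be jointly measurable and such that, for each $\theta\in\Theta$, it is for almost every $z$ (under the law of $Z$) a gradient or a subgradient of $l(z,\cdot)$ on $\Theta$ at $\theta$. Let $\theta^*=\arg\min_{\theta\in\Theta}L(\theta)$. **Algorithm.** Let $B_1,B_2,\dots$ be positive integers, and $$I_t=\Big\{2\sum_{i<t}B_i+1,\dots,2\sum_{i<t}B_i+B_t\Big\},\qquad J_t=\Big\{2\sum_{i<t}B_i+B_t+1,\dots,2\sum_{i\le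 t}B_i\Big\}.$$ Let $\Pi$ be the Euclidean projection onto $\Theta$. For deterministic initial values $\theta_0^a,\theta_0^b$ and $t\ge1$ let $$\theta_t^a=\Pi\Big\{\theta_{t-1}^a-\frac{\gamma_t}{B_t}\sum_{i\in I_t}\nabla l(Z_i,\theta_{t-1}^a)\Big\},\quad \theta_t^b=\Pi\Big\{\theta_{t-1}^b-\frac{\gamma_t}{B_t}\sum_{i\in J_t}\nabla l(Z_i,\theta_{t-1}^b)\Big\},\quad \overline\theta_T=\frac1{2T}\sum_{t=1}^T(\theta_t^a+\theta_t^b).$$ **Assumptions.** There are constants $K,\delta,\gamma>0$, $p>2$, $\rho\in(1/2,1)$, a function $M$ and a sequence $\phi(t)$, $t\ge1$, such that the following hold. 1. $(Z_t)_{t\ge1}$ is strictly stationary and $\phi_{\mathbf Z}(t)\le\phi(t)$ for all $t\ge1$, where $\phi(t)$ is nonincreasing with limit $0$. With $r(t)=\mathbb E[\nabla l(Z_{k+t},\theta^*)\nabla l(Z_k,\theta^*)^\top]$, the matrix $r(0)+2\sum_{t\ge1}r(t)$ is positive definite (as a quadratic form). 2. $\Theta$ is compact and convex. $L$ is strongly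 convex and continuously differentiable on $\Theta$, and twice continuously differentiable on $\Theta_\delta=\{\theta\in\Theta:\|\theta-\theta^*\|\le\delta\}$. The point $\theta^*$ lies in the interior of $\Theta$ and is the unique solution of $\nabla L(\theta)=0$ in $\Theta$. For all $\theta,\tilde\theta\in\Theta$, $\|\nabla L(\theta)-\nabla L(\tilde\theta)\|\le K\|\theta-\tilde\theta\|$. The Hessian $\nabla^2L(\theta^*)$ is positive definite, and $\|\nabla^2L(\theta)-\nabla^2L(\theta^*)\|\le K\|\theta-\theta^*\|$ for all $\theta\in\Theta_\delta$. (At boundary points, derivatives are taken relative to the set.) 3. Almost surely $\sup_{\theta\in\Theta}\|\nabla l(Z,\theta)\|\le M(Z)$, and $\mathbb E[M(Z)^p]<\infty$. Moreover $\mathbb E[\nabla l(Z,\theta)]=\nabla L(\theta)$ for all $\theta\in\Theta$. 4. $\gamma_t=(t+\gamma)^{-\rho}$; $\sum_{t\ge1}\phi(t)^{1/2}<\infty$ and $\sum_{t\ge1}\phi(t)^{1-2/p}<\infty$; $B_t$ is nondecreasing with $B_t\to\infty$; and $\sum_{t\ge1}t^{-\rho}\phi(B_t)^{1/2-1/p}<\infty$.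 **Theorem.** Almost surely, as $T\to\infty$, $\theta_T^a\to\theta^*$, $\theta_T^b\to\theta^*$ and $\overline\theta_T\to\theta^*$. -/

import Mathlib

open MeasureTheory ProbabilityTheory Filter Topology Set
open scoped ENNReal

namespace PhiSGD

noncomputable section

/-! ### Mixing and stationarity.  Time series are indexed by `1, 2, 3, …`; `Z 0` is never used. -/

/-- `φ_P(𝓑, 𝓐) = sup { |P(A ∣ B) - P(A)| : A ∈ 𝓐, B ∈ 𝓑, P(B) > 0 }`. -/
def phiCoeff {Ω : Type*} [MeasurableSpace Ω] (P : Measure Ω) (𝓑 𝓐 : MeasurableSpace Ω) : ℝ≥0∞ :=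
  ⨆ (B : Set Ω) (A : Set Ω) (_ : MeasurableSet[𝓑] B) (_ : MeasurableSet[𝓐] A) (_ : P B ≠ 0),
    ENNReal.ofReal |(ProbabilityTheory.cond P B).real A - P.real A|

/-- The sigma-algebra generated by the `Z t` with index `t` in `S`. -/
abbrev sigmaGen {Ω 𝒵 : Type*} [MeasurableSpace 𝒵] (Z : ℕ → Ω → 𝒵) (S : Set ℕ) : MeasurableSpace Ω :=
  ⨆ t ∈ S, MeasurableSpace.comap (Z t) inferInstance

/-- `φ_Z(t) = sup_{s ≥ 1} φ_P(𝓕_1^s, 𝓕_{s+t}^∞)`. -/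
def phiMixing {Ω 𝒵 : Type*} [MeasurableSpace Ω] [MeasurableSpace 𝒵] (P : Measure Ω)
    (Z : ℕ → Ω → 𝒵) (t : ℕ) : ℝ≥0∞ :=
  ⨆ (s : ℕ) (_ : 1 ≤ s), phiCoeff P (sigmaGen Z (Icc 1 s)) (sigmaGen Z (Ici (s + t)))

/-- Strict stationarity of `Z 1, Z 2, …`: all shifts of the sequence have the same law. -/
def Stationary {Ω 𝒵 : Type*} [MeasurableSpace Ω] [MeasurableSpace 𝒵] (P : Measure Ω)
    (Z : ℕ → Ω → 𝒵) : Prop :=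
  ∀ h : ℕ, P.map (fun ω (i : ℕ) => Z (i + 1 + h) ω) = P.map (fun ω (i : ℕ) => Z (i + 1) ω)

/-! ### Loss, gradients, Hessian -/

/-- The expected loss `L(θ) = E[l(Z, θ)]`, where `μ` is the law of `Z`. -/
def expLoss {𝒵 : Type*} [MeasurableSpace 𝒵] {d : ℕ} (μ : Measure 𝒵)
    (l : 𝒵 → EuclideanSpace ℝ (Fin d) → ℝ) (θ : EuclideanSpace ℝ (Fin d)) : ℝ :=
  ∫ z, l z θ ∂μ

/-- `v` is the gradient, or a subgradient, at `θ` of the function `f` on `Θ`. -/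
def IsGradOrSubgrad {d : ℕ} (Θ : Set (EuclideanSpace ℝ (Fin d)))
    (f : EuclideanSpace ℝ (Fin d) → ℝ) (θ v : EuclideanSpace ℝ (Fin d)) : Prop :=
  HasGradientWithinAt f v Θ θ ∨ ∀ y ∈ Θ, f θ + inner ℝ v (y - θ) ≤ f y

/-- The Hessian of `f` on `S` at `θ`, as a bilinear form (with its operator norm). -/
def hessOn {d : ℕ} (f : EuclideanSpace ℝ (Fin d) → ℝ) (S : Set (EuclideanSpace ℝ (Fin d)))
    (θ : EuclideanSpace ℝ (Fin d)) :
    EuclideanSpace ℝ (Fin d) →L[ℝ] EuclideanSpace ℝ (Fin d) →L[ℝ] ℝ :=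
  fderivWithin ℝ (fderivWithin ℝ f S) S θ

/-- `r(t) = E[g(Z_{k+t}) g(Z_k)ᵀ]`, taken at `k = 1` (by stationarity `k` does not matter). -/
def autocov {Ω 𝒵 : Type*} [MeasurableSpace Ω] {d : ℕ} (P : Measure Ω) (Z : ℕ → Ω → 𝒵)
    (g : 𝒵 → EuclideanSpace ℝ (Fin d)) (t : ℕ) : Matrix (Fin d) (Fin d) ℝ :=
  Matrix.of fun i j => ∫ ω, g (Z (1 + t) ω) i * g (Z 1 ω) j ∂P

/-! ### The algorithm -/

/-- The Euclidean projection onto `Θ`: a point of `Θ` nearest to `x` (unique if `Θ` is convex). -/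
def projOn {d : ℕ} (Θ : Set (EuclideanSpace ℝ (Fin d))) (x : EuclideanSpace ℝ (Fin d)) :
    EuclideanSpace ℝ (Fin d) :=
  Classical.epsilon fun y => y ∈ Θ ∧ ∀ w ∈ Θ, dist x y ≤ dist x w

theorem projOn_spec {d : ℕ} {Θ : Set (EuclideanSpace ℝ (Fin d))} (hΘ : IsCompact Θ)
    (hne : Θ.Nonempty) (x : EuclideanSpace ℝ (Fin d)) :
    projOn Θ x ∈ Θ ∧ ∀ w ∈ Θ, dist x (projOn Θ x) ≤ dist x w := by
  obtain ⟨y, hy, hmin⟩ := hΘ.exists_isMinOn hne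
    (continuous_const.dist continuous_id : Continuous fun w => dist x w).continuousOn
  exact Classical.epsilon_spec
    (p := fun y => y ∈ Θ ∧ ∀ w ∈ Θ, dist x y ≤ dist x w) ⟨y, hy, fun w hw => hmin hw⟩

/-- `I_t = {2 ∑_{i<t} B_i + 1, …, 2 ∑_{i<t} B_i + B_t}`. -/
def blockI (B : ℕ → ℕ) (t : ℕ) : Finset ℕ :=
  Finset.Icc (2 * (∑ i ∈ Finset.Ico 1 t, B i) + 1) (2 * (∑ i ∈ Finset.Ico 1 t, B i) + B t)

/-- `J_t = {2 ∑_{i<t} B_i + B_t + 1, …, 2 ∑_{i≤t} B_i}`. -/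
def blockJ (B : ℕ → ℕ) (t : ℕ) : Finset ℕ :=
  Finset.Icc (2 * (∑ i ∈ Finset.Ico 1 t, B i) + B t + 1) (2 * ∑ i ∈ Finset.Icc 1 t, B i)

/-- The mini-batch gradient `(1 / b) ∑_{i ∈ I} ∇l(Z_i, θ)`, `H` being the (sub)gradient of `l`. -/
def miniGrad {𝒵 : Type*} {d : ℕ}
    (H : 𝒵 → EuclideanSpace ℝ (Fin d) → EuclideanSpace ℝ (Fin d))
    (b : ℕ) (I : Finset ℕ) (z : ℕ → 𝒵) (θ : EuclideanSpace ℝ (Fin d)) :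
    EuclideanSpace ℝ (Fin d) :=
  (1 / (b : ℝ)) • ∑ i ∈ I, H (z i) θ

/-- Projected mini-batch SGD on the data `z 1, z 2, …` with step sizes `γ t`, batch sizes `B t`,
blocks `blk t` and initial value `θ₀`:
`θ_t = Proj {θ_{t-1} - γ_t (1 / B_t) ∑_{i ∈ blk t} ∇l(z_i, θ_{t-1})}`. -/
def sgd {𝒵 : Type*} {d : ℕ} (Θ : Set (EuclideanSpace ℝ (Fin d)))
    (H : 𝒵 → EuclideanSpace ℝ (Fin d) → EuclideanSpace ℝ (Fin d))
    (γ : ℕ → ℝ) (B : ℕ → ℕ) (blk : ℕ → Finset ℕ) (θ₀ : EuclideanSpace ℝ (Fin d))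
    (z : ℕ → 𝒵) : ℕ → EuclideanSpace ℝ (Fin d)
  | 0 => θ₀
  | t + 1 =>
      projOn Θ (sgd Θ H γ B blk θ₀ z t
        - γ (t + 1) • miniGrad H (B (t + 1)) (blk (t + 1)) z (sgd Θ H γ B blk θ₀ z t))

/-- The Polyak–Ruppert average `(1 / (2T)) ∑_{t=1}^T (a_t + b_t)` of two trajectories. -/
def polyakRuppert {d : ℕ} (a b : ℕ → EuclideanSpace ℝ (Fin d)) (T : ℕ) :
    EuclideanSpace ℝ (Fin d) :=
  (1 / (2 * (T : ℝ))) • ∑ t ∈ Finset.Icc 1 T, (a t + b t)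

/-- The learning rate `γ_t = (t + γ)^{-ρ}`. -/
def learningRate (γ ρ : ℝ) (t : ℕ) : ℝ := ((t : ℝ) + γ) ^ (-ρ)

/-! ### Assumptions -/

/-- Distributional assumptions on the time series; `g z` stands for the (sub)gradient
`∇l(z, θ*)`. -/
structure DataAssumptions {Ω 𝒵 : Type*} [MeasurableSpace Ω] [MeasurableSpace 𝒵] {d : ℕ}
    (P : Measure Ω) (Z : ℕ → Ω → 𝒵) (φ : ℕ → ℝ)
    (g : 𝒵 → EuclideanSpace ℝ (Fin d)) : Prop where
  measurable : ∀ t, 1 ≤ t → Measurable (Z t)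
  stationary : Stationary P Z
  mixing_le : ∀ t, 1 ≤ t → phiMixing P Z t ≤ ENNReal.ofReal (φ t)
  antitone : AntitoneOn φ (Ici 1)
  tendsto_zero : Tendsto φ atTop (𝓝 0)
  /-- `r(0) + 2 ∑_{t ≥ 1} r(t)` is positive definite (as a quadratic form). -/
  posDef : ∀ v : Fin d → ℝ, v ≠ 0 →
    0 < v ⬝ᵥ ((autocov P Z g 0 + (2 : ℝ) • ∑' t : ℕ, autocov P Z g (t + 1)).mulVec v)

/-- Assumptions on the parameter space and the loss; `μ` is the law of an observation, `L` the
expected loss, `∇L` its gradient on `Θ`, `H z θ` a (sub)gradient of `l z` at `θ`. -/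
structure LossAssumptions {𝒵 : Type*} [MeasurableSpace 𝒵] {d : ℕ} (μ : Measure 𝒵)
    (Θ : Set (EuclideanSpace ℝ (Fin d))) (θs : EuclideanSpace ℝ (Fin d))
    (l : 𝒵 → EuclideanSpace ℝ (Fin d) → ℝ)
    (H : 𝒵 → EuclideanSpace ℝ (Fin d) → EuclideanSpace ℝ (Fin d))
    (M : 𝒵 → ℝ) (p K δ : ℝ) : Prop where
  K_pos : 0 < K
  δ_pos : 0 < δ
  integrable_loss : ∀ θ ∈ Θ, Integrable (fun z => l z θ) μ
  measurable_grad : Measurable (Function.uncurry H)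
  isGrad : ∀ θ ∈ Θ, ∀ᵐ z ∂μ, IsGradOrSubgrad Θ (l z) θ (H z θ)
  compact : IsCompact Θ
  /-- strong convexity on `Θ`, which contains the convexity of `Θ` -/
  strongConvex : ∃ m : ℝ, 0 < m ∧ StrongConvexOn Θ m (expLoss μ l)
  contDiff : ContDiffOn ℝ 1 (expLoss μ l) Θ
  contDiff_two : ContDiffOn ℝ 2 (expLoss μ l) (Θ ∩ Metric.closedBall θs δ)
  argmin : IsMinOn (expLoss μ l) Θ θs
  grad_eq_zero : gradientWithin (expLoss μ l) Θ θs = 0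
  unique_zero : ∀ θ ∈ Θ, gradientWithin (expLoss μ l) Θ θ = 0 → θ = θs
  mem_interior : θs ∈ interior Θ
  lipschitz_grad : ∀ θ ∈ Θ, ∀ θ' ∈ Θ,
    ‖gradientWithin (expLoss μ l) Θ θ - gradientWithin (expLoss μ l) Θ θ'‖ ≤ K * ‖θ - θ'‖
  hess_posDef : ∀ v : EuclideanSpace ℝ (Fin d), v ≠ 0 →
    0 < hessOn (expLoss μ l) (Θ ∩ Metric.closedBall θs δ) θs v v
  lipschitz_hess : ∀ θ ∈ Θ ∩ Metric.closedBall θs δ,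
    ‖hessOn (expLoss μ l) (Θ ∩ Metric.closedBall θs δ) θ
      - hessOn (expLoss μ l) (Θ ∩ Metric.closedBall θs δ) θs‖ ≤ K * ‖θ - θs‖
  two_lt_p : 2 < p
  grad_le : ∀ᵐ z ∂μ, ∀ θ ∈ Θ, ‖H z θ‖ ≤ M z
  moment : Integrable (fun z => M z ^ p) μ
  unbiased : ∀ θ ∈ Θ, ∫ z, H z θ ∂μ = gradientWithin (expLoss μ l) Θ θ

/-- Rate conditions on the learning rate, the mixing coefficients and the batch sizes. -/
structure RateAssumptions (φ : ℕ → ℝ) (B : ℕ → ℕ) (p γ ρ : ℝ) : Prop where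
  γ_pos : 0 < γ
  half_lt_ρ : 1 / 2 < ρ
  ρ_lt_one : ρ < 1
  summable_sqrt : Summable fun t : ℕ => φ (t + 1) ^ ((1 : ℝ) / 2)
  summable_pow : Summable fun t : ℕ => φ (t + 1) ^ (1 - 2 / p)
  batch_pos : ∀ t, 1 ≤ t → 1 ≤ B t
  batch_mono : MonotoneOn B (Ici 1)
  batch_tendsto : Tendsto B atTop atTop
  summable_batch : Summable fun t : ℕ =>
    ((t + 1 : ℕ) : ℝ) ^ (-ρ) * φ (B (t + 1)) ^ ((1 : ℝ) / 2 - 1 / p)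

end

end PhiSGD

open PhiSGD

namespace PhiSGD

/-! ### Covariance inequality for `φ`-mixing pairs -/

/-! Let `V` be the squared distance of the iterate to `θs`. The projection is nonexpansive and fixes
`θs`, so with step size `η` and mini-batch gradient `G` one step gives `V' ≤ V - 2 η ⟨θ - θs, G⟩ +
η² ‖G‖²`. Split `G` into its mean `∇L(θ)` and noise. Strong convexity turns the mean into a
contraction: `⟨θ - θs, ∇L(θ)⟩ ≥ (m/4) V` (`inner_gradientWithin_ge_of_strongConvexOn`). The terms
`η² ‖G‖²` have summable expectations because `ρ > 1/2`.

The noise is not a martingale difference, since the data are dependent. But each trajectory skips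
the block used by the other one, so the current iterate and the next batch are separated by a gap of
at least `B t`. By `φ`-mixing their joint law is within `φ (B t)` of the product law in total
variation, and under the product law the noise is centered. Truncation in `L²` converts this into a
conditional mean of `L¹` size `O(√φ (B t))` (`integral_comp_le_of_phiCoeff`,
`integral_mul_gradNoise_le`). Weighted by `η` these bounds are summable by the batch-size condition;
the noise minus its conditional mean is a martingale difference with summable variances. Hence the
signed noise series converges almost surely (`ae_exists_tendsto_sum`).

On each path there remains a recursion `V' ≤ V - a V + e` with `∑ e` convergent and `∑ a = ∞`, which
forces `V → 0` (`tendsto_zero_of_recursive_le`). The average then converges by Cesàro. -/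

/-- Sets of the form `{(x, y) | y ∈ D (g x)}` where `g` takes finitely many values. -/
def finiteSectionSets (𝒳 𝒴 : Type*) [MeasurableSpace 𝒳] [MeasurableSpace 𝒴] :
    Set (Set (𝒳 × 𝒴)) :=
  {C | ∃ (n : ℕ) (g : 𝒳 → Fin n) (D : Fin n → Set 𝒴), Measurable g ∧
    (∀ i, MeasurableSet (D i)) ∧ C = {q | q.2 ∈ D (g q.1)}}

theorem finiteSectionSets_of_fintype {𝒳 𝒴 ι : Type*} [MeasurableSpace 𝒳] [MeasurableSpace 𝒴]
    [Fintype ι] [MeasurableSpace ι] [DiscreteMeasurableSpace ι] {g : 𝒳 → ι} (hg : Measurable g)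
    {D : ι → Set 𝒴} (hD : ∀ i, MeasurableSet (D i)) :
    {q : 𝒳 × 𝒴 | q.2 ∈ D (g q.1)} ∈ finiteSectionSets 𝒳 𝒴 := by
  refine ⟨Fintype.card ι, fun x => Fintype.equivFin ι (g x),
    fun i => D ((Fintype.equivFin ι).symm i), ?_, fun i => hD _, by simp⟩
  exact (measurable_of_countable _).comp hg

theorem isSetAlgebra_finiteSectionSets (𝒳 𝒴 : Type*) [MeasurableSpace 𝒳] [MeasurableSpace 𝒴] :
    IsSetAlgebra (finiteSectionSets 𝒳 𝒴) where
  empty_mem := ⟨1, fun _ => 0, fun _ => ∅, measurable_const, fun _ => MeasurableSet.empty, by simp⟩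
  compl_mem := by
    rintro s ⟨n, g, D, hg, hD, rfl⟩
    exact ⟨n, g, fun i => (D i)ᶜ, hg, fun i => (hD i).compl, rfl⟩
  union_mem := by
    rintro s t ⟨n, g, D, hg, hD, rfl⟩ ⟨n', g', D', hg', hD', rfl⟩
    -- The pair of labels realises the common refinement of the two partitions.
    exact finiteSectionSets_of_fintype (hg.prodMk hg') (D := fun i => D i.1 ∪ D' i.2)
      fun i => (hD _).union (hD' _)

theorem generateFrom_finiteSectionSets (𝒳 𝒴 : Type*) [MeasurableSpace 𝒳] [MeasurableSpace 𝒴] :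
    (inferInstance : MeasurableSpace (𝒳 × 𝒴)) =
      MeasurableSpace.generateFrom (finiteSectionSets 𝒳 𝒴) := by
  classical
  apply le_antisymm
  · rw [← generateFrom_prod]
    apply MeasurableSpace.generateFrom_mono
    rintro _ ⟨A, hA, D, hD, rfl⟩
    have := finiteSectionSets_of_fintype (𝒴 := 𝒴) (g := fun x => if x ∈ A then true else false)
      (Measurable.ite hA measurable_const measurable_const) (D := fun b => if b then D else ∅)
      (by intro b; cases b <;> simp [show MeasurableSet D from hD])
    convert this using 1
    ext ⟨x, y⟩
    by_cases hx : x ∈ A <;> simp [hx]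
  · apply MeasurableSpace.generateFrom_le
    rintro s ⟨n, g, D, hg, hD, rfl⟩
    have : {q : 𝒳 × 𝒴 | q.2 ∈ D (g q.1)} = ⋃ i, (g ⁻¹' {i}) ×ˢ D i := by
      ext ⟨x, y⟩; simp
    rw [this]
    exact MeasurableSet.iUnion fun i => (hg (measurableSet_singleton i)).prod (hD i)

theorem measureReal_finiteSection {𝒳 𝒴 : Type*} [MeasurableSpace 𝒳] [MeasurableSpace 𝒴]
    (ν : Measure (𝒳 × 𝒴)) [IsFiniteMeasure ν] {n : ℕ} {g : 𝒳 → Fin n} (hg : Measurable g)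
    {D : Fin n → Set 𝒴} (hD : ∀ i, MeasurableSet (D i)) :
    ν.real {q | q.2 ∈ D (g q.1)} = ∑ i, ν.real ((g ⁻¹' {i}) ×ˢ D i) := by
  have : {q : 𝒳 × 𝒴 | q.2 ∈ D (g q.1)} = ⋃ i, (g ⁻¹' {i}) ×ˢ D i := by
    ext ⟨x, y⟩; simp
  rw [this, measureReal_iUnion_fintype]
  · intro i j hij
    refine Set.disjoint_left.2 ?_
    rintro ⟨x, y⟩ ⟨h1, -⟩ ⟨h2, -⟩
    exact hij (h1.symm.trans h2)
  · exact fun i => (hg (measurableSet_singleton i)).prod (hD i)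

/-- If rectangles satisfy the `φ`-mixing bound, the joint law is within `ε` of the product law in
total variation. -/
theorem abs_measureReal_sub_prod_le {𝒳 𝒴 : Type*} [MeasurableSpace 𝒳] [MeasurableSpace 𝒴]
    (ν : Measure (𝒳 × 𝒴)) [IsFiniteMeasure ν] (α : Measure 𝒳) [IsProbabilityMeasure α]
    (β : Measure 𝒴) [IsProbabilityMeasure β] {ε : ℝ}
    (h : ∀ A D, MeasurableSet A → MeasurableSet D →
      |ν.real (A ×ˢ D) - α.real A * β.real D| ≤ ε * α.real A)
    {C : Set (𝒳 × 𝒴)} (hC : MeasurableSet C) :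
    |ν.real C - (α.prod β).real C| ≤ ε := by
  have key : ∀ C ∈ finiteSectionSets 𝒳 𝒴, |ν.real C - (α.prod β).real C| ≤ ε := by
    rintro C ⟨n, g, D, hg, hD, rfl⟩
    rw [measureReal_finiteSection ν hg hD, measureReal_finiteSection _ hg hD,
      ← Finset.sum_sub_distrib]
    have h1 : ∑ i, α.real (g ⁻¹' {i}) = 1 := by
      rw [← measureReal_iUnion_fintype]
      · have : (⋃ i, g ⁻¹' {i}) = univ := by ext; simp
        rw [this]; simp
      · intro i j hij
        exact Set.disjoint_left.2 fun x h1 h2 => hij (h1.symm.trans h2)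
      · exact fun i => hg (measurableSet_singleton i)
    -- The factor `α.real A` in the rectangle bound is decisive: over a partition these weights sum
    -- to one, so the error does not grow with the number of cells.
    calc _ ≤ ∑ i, |ν.real ((g ⁻¹' {i}) ×ˢ D i) - (α.prod β).real ((g ⁻¹' {i}) ×ˢ D i)| :=
          Finset.abs_sum_le_sum_abs _ _
      _ ≤ ∑ i, ε * α.real (g ⁻¹' {i}) := by
          refine Finset.sum_le_sum fun i _ => ?_
          rw [measureReal_prod_prod]
          exact h _ _ (hg (measurableSet_singleton i)) (hD i)
      _ = ε := by rw [← Finset.mul_sum, h1, mul_one]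
  refine le_of_forall_pos_le_add fun η hη => ?_
  -- Approximating with respect to the sum of the two measures makes both errors together smaller
  -- than `η`.
  obtain ⟨t, ht, hlt⟩ := exists_measure_symmDiff_lt_of_generateFrom_isSetRing
    (μ := ν + α.prod β) (isSetAlgebra_finiteSectionSets 𝒳 𝒴).isSetRing
    ⟨{univ}, countable_singleton _,
      singleton_subset_iff.2 (isSetAlgebra_finiteSectionSets 𝒳 𝒴).univ_mem, by simp⟩
    (generateFrom_finiteSectionSets 𝒳 𝒴) hC (ε := ENNReal.ofReal η) (by simpa using hη)
  have htm : MeasurableSet t := by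
    have := MeasurableSpace.measurableSet_generateFrom ht
    rwa [← generateFrom_finiteSectionSets 𝒳 𝒴] at this
  have h1 := abs_measureReal_sub_le_measureReal_symmDiff (μ := ν) htm.nullMeasurableSet
    hC.nullMeasurableSet
  have h2 := abs_measureReal_sub_le_measureReal_symmDiff (μ := α.prod β) htm.nullMeasurableSet
    hC.nullMeasurableSet
  have h3 : (ν + α.prod β).real (symmDiff t C) < η := by
    rw [measureReal_def]
    exact (ENNReal.lt_ofReal_iff_toReal_lt (measure_ne_top _ _)).1 hlt
  rw [measureReal_add_apply] at h3
  have h4 := key t ht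
  rw [abs_le] at *
  constructor <;> linarith

/-- Layer cake for `g + n`, which takes values in `[0, 2n]`: each superlevel set contributes at most
`ε`, over a range of length `2n`. -/
theorem integral_sub_integral_le_of_bounded {S : Type*} [MeasurableSpace S] (ν ν' : Measure S)
    [IsProbabilityMeasure ν] [IsProbabilityMeasure ν'] {ε : ℝ}
    (h : ∀ C, MeasurableSet C → |ν.real C - ν'.real C| ≤ ε) {g : S → ℝ} (hg : Measurable g)
    {n : ℝ} (hn : 0 ≤ n) (hb : ∀ x, |g x| ≤ n) :
    ∫ x, g x ∂ν - ∫ x, g x ∂ν' ≤ 2 * n * ε := by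
  have hi : ∀ (ρ : Measure S) [IsProbabilityMeasure ρ], Integrable g ρ := fun ρ _ =>
    Integrable.of_bound hg.aestronglyMeasurable n (ae_of_all _ hb)
  have hlc : ∀ (ρ : Measure S) [IsProbabilityMeasure ρ],
      ∫ x, g x ∂ρ + n = ∫ t in Ioc 0 (2 * n), ρ.real {a | t ≤ g a + n} := by
    intro ρ _
    rw [← Integrable.integral_eq_integral_Ioc_meas_le (f := fun x => g x + n)
      ((hi ρ).add (integrable_const n))
      (ae_of_all _ fun x => by have := (abs_le.1 (hb x)).1; simp; linarith)
      (ae_of_all _ fun x => by have := (abs_le.1 (hb x)).2; simp; linarith),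
      integral_add (hi ρ) (integrable_const n)]
    simp
  have hint : ∀ (ρ : Measure S) [IsProbabilityMeasure ρ],
      IntegrableOn (fun t => ρ.real {a | t ≤ g a + n}) (Ioc 0 (2 * n)) := by
    intro ρ _
    refine Measure.integrableOn_of_bounded (M := 1) measure_Ioc_lt_top.ne ?_ (ae_of_all _ fun t => ?_)
    · refine Measurable.aestronglyMeasurable (Antitone.measurable fun s t hst => ?_)
      exact measureReal_mono fun a (ha : t ≤ _) => hst.trans ha
    · rw [Real.norm_of_nonneg measureReal_nonneg]
      exact measureReal_le_one
  have hsub : ∫ x, g x ∂ν - ∫ x, g x ∂ν'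
      = ∫ t in Ioc 0 (2 * n), (ν.real {a | t ≤ g a + n} - ν'.real {a | t ≤ g a + n}) := by
    rw [integral_sub (hint ν) (hint ν'), ← hlc, ← hlc]; ring
  rw [hsub]
  calc _ ≤ ∫ t in Ioc 0 (2 * n), ε := by
        refine setIntegral_mono ((hint ν).sub (hint ν'))
          (integrableOn_const measure_Ioc_lt_top.ne) fun t => ?_
        exact (abs_le.1 (h _ (measurableSet_le measurable_const (hg.add_const n)))).2
    _ = 2 * n * ε := by simp [hn]

/-- Truncating at level `n` costs at most `κ / n` under each measure, and the bounded part costs `2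
n ε`; the level `n = 1 / √ε` balances the two. For `ε = 0` no such level exists, but then the
measures coincide. -/
theorem integral_sub_integral_le {S : Type*} [MeasurableSpace S] (ν ν' : Measure S)
    [IsProbabilityMeasure ν] [IsProbabilityMeasure ν'] {ε : ℝ}
    (h : ∀ C, MeasurableSet C → |ν.real C - ν'.real C| ≤ ε) {f : S → ℝ} (hf : Measurable f)
    (hν : MemLp f 2 ν) (hν' : MemLp f 2 ν') {κ : ℝ}
    (hκ : ∫ x, f x ^ 2 ∂ν ≤ κ) (hκ' : ∫ x, f x ^ 2 ∂ν' ≤ κ) :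
    ∫ x, f x ∂ν - ∫ x, f x ∂ν' ≤ (2 + 2 * κ) * √ε := by
  have hε : 0 ≤ ε := (abs_nonneg _).trans (h ∅ MeasurableSet.empty)
  rcases hε.eq_or_lt with rfl | hε
  · have : ν = ν' := by
      refine Measure.ext fun C hC => ?_
      have h0 := h C hC
      rw [abs_nonpos_iff, sub_eq_zero, measureReal_def, measureReal_def,
        ENNReal.toReal_eq_toReal_iff' (measure_ne_top _ _) (measure_ne_top _ _)] at h0
      exact h0
    subst this
    simp
  set n : ℝ := (√ε)⁻¹ with hn
  have hs : 0 < √ε := Real.sqrt_pos.2 hε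
  have hn0 : 0 < n := inv_pos.2 hs
  set g : S → ℝ := fun x => max (-n) (min n (f x)) with hgdef
  have hgm : Measurable g := measurable_const.max (measurable_const.min hf)
  have hgb : ∀ x, |g x| ≤ n := fun x => by
    rw [abs_le]
    exact ⟨le_max_left _ _, max_le (by linarith) (min_le_left _ _)⟩
  have hdiff : ∀ x, |f x - g x| ≤ √ε * f x ^ 2 := by
    intro x
    have hns : √ε * n = 1 := mul_inv_cancel₀ hs.ne'
    have e : √ε * f x ^ 2 - |f x| = √ε * |f x| * (|f x| - n) := by
      rw [← sq_abs (f x)]; linear_combination |f x| * hns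
    simp only [hgdef]
    rcases le_total (f x) n with h1 | h1
    · rcases le_total (-n) (f x) with h2 | h2
      · rw [min_eq_right h1, max_eq_right h2, sub_self, abs_zero]; positivity
      · have h3 : |f x| = -f x := abs_of_nonpos (by linarith)
        have : 0 ≤ √ε * |f x| * (|f x| - n) :=
          mul_nonneg (by positivity) (by linarith)
        rw [min_eq_right h1, max_eq_left h2, abs_of_nonpos (by linarith)]
        linarith
    · have h3 : |f x| = f x := abs_of_nonneg (by linarith)
      have : 0 ≤ √ε * |f x| * (|f x| - n) :=
        mul_nonneg (by positivity) (by linarith)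
      rw [min_eq_left h1, max_eq_right (by linarith), abs_of_nonneg (by linarith)]
      linarith
  have happrox : ∀ (ρ : Measure S) [IsProbabilityMeasure ρ], MemLp f 2 ρ →
      ∫ x, f x ^ 2 ∂ρ ≤ κ → |∫ x, f x ∂ρ - ∫ x, g x ∂ρ| ≤ √ε * κ := by
    intro ρ _ hL hk
    have hfi : Integrable f ρ := hL.integrable (by norm_num)
    have hgi : Integrable g ρ :=
      Integrable.of_bound hgm.aestronglyMeasurable n (ae_of_all _ hgb)
    rw [← integral_sub hfi hgi]
    calc _ ≤ ∫ x, |f x - g x| ∂ρ := abs_integral_le_integral_abs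
      _ ≤ ∫ x, √ε * f x ^ 2 ∂ρ :=
          integral_mono (hfi.sub hgi).abs (hL.integrable_sq.const_mul _) hdiff
      _ ≤ √ε * κ := by
          rw [integral_const_mul]
          exact mul_le_mul_of_nonneg_left hk hs.le
  have h1 := (abs_le.1 (happrox ν hν hκ)).2
  have h2 := (abs_le.1 (happrox ν' hν' hκ')).1
  have h3 := integral_sub_integral_le_of_bounded ν ν' h hgm hn0.le hgb
  have h4 : 2 * n * ε = 2 * √ε := by
    have : √ε * √ε = ε := Real.mul_self_sqrt hε.le
    rw [hn]; field_simp; nlinarith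
  linarith

/-- Multiplying the conditional form by `P B` removes the division, and the bound then holds for
null `B` as well. -/
theorem abs_measureReal_inter_sub_le_of_phiCoeff {Ω : Type*} {𝓑 𝓐 mΩ : MeasurableSpace Ω}
    {P : Measure Ω} [IsProbabilityMeasure P] (h𝓑 : 𝓑 ≤ mΩ)
    {ε : ℝ} (hε : 0 ≤ ε) (h : phiCoeff P 𝓑 𝓐 ≤ ENNReal.ofReal ε) {A B : Set Ω}
    (hA : MeasurableSet[𝓐] A) (hB : MeasurableSet[𝓑] B) :
    |P.real (B ∩ A) - P.real B * P.real A| ≤ ε * P.real B := by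
  by_cases h0 : P B = 0
  · have h1 : P.real B = 0 := by simp [measureReal_def, h0]
    have h2 : P.real (B ∩ A) = 0 :=
      le_antisymm ((measureReal_mono inter_subset_left).trans h1.le) measureReal_nonneg
    simp [h1, h2]
  have hle : ENNReal.ofReal |(ProbabilityTheory.cond P B).real A - P.real A|
      ≤ ENNReal.ofReal ε := by
    refine le_trans ?_ h
    unfold phiCoeff
    exact le_iSup_of_le B (le_iSup_of_le A (le_iSup_of_le hB (le_iSup_of_le hA
      (le_iSup_of_le h0 le_rfl))))
  have hcond : (ProbabilityTheory.cond P B).real A = (P.real B)⁻¹ * P.real (B ∩ A) := by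
    simp only [measureReal_def, cond_apply (h𝓑 B hB), ENNReal.toReal_mul, ENNReal.toReal_inv]
  rw [ENNReal.ofReal_le_ofReal_iff hε, hcond] at hle
  have hpos : 0 < P.real B := by
    rw [measureReal_def]; exact ENNReal.toReal_pos h0 (measure_ne_top _ _)
  have : P.real (B ∩ A) - P.real B * P.real A
      = ((P.real B)⁻¹ * P.real (B ∩ A) - P.real A) * P.real B := by
    field_simp
  rw [this, abs_mul, abs_of_pos hpos]
  exact mul_le_mul_of_nonneg_right hle hpos.le

/-- Decoupling inequality: for `X` measurable with respect to the past and `Y` with respect to the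
future, replacing the joint law of `(X, Y)` by the product of the marginals costs `O(√φ)`. -/
theorem integral_comp_le_of_phiCoeff {Ω 𝒳 𝒴 : Type*} {𝓑 𝓐 mΩ : MeasurableSpace Ω}
    [MeasurableSpace 𝒳] [MeasurableSpace 𝒴] {P : Measure Ω} [IsProbabilityMeasure P]
    (h𝓑 : 𝓑 ≤ mΩ) {ε : ℝ} (hε : 0 ≤ ε)
    (h : phiCoeff P 𝓑 𝓐 ≤ ENNReal.ofReal ε) {X : Ω → 𝒳} {Y : Ω → 𝒴} (hX : Measurable[𝓑] X)
    (hY : Measurable Y) (hY𝓐 : MeasurableSpace.comap Y inferInstance ≤ 𝓐)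
    {f : 𝒳 × 𝒴 → ℝ} (hf : Measurable f)
    (hL : MemLp (fun ω => f (X ω, Y ω)) 2 P) (hL' : MemLp f 2 ((P.map X).prod (P.map Y))) {κ : ℝ}
    (hκ : ∫ ω, f (X ω, Y ω) ^ 2 ∂P ≤ κ)
    (hκ' : ∫ q, f q ^ 2 ∂((P.map X).prod (P.map Y)) ≤ κ) :
    ∫ ω, f (X ω, Y ω) ∂P ≤ ∫ q, f q ∂((P.map X).prod (P.map Y)) + (2 + 2 * κ) * √ε := by
  have hX' : Measurable X := hX.mono h𝓑 le_rfl
  have hXY : Measurable fun ω => (X ω, Y ω) := hX'.prodMk hY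
  have := Measure.isProbabilityMeasure_map (μ := P) hX'.aemeasurable
  have := Measure.isProbabilityMeasure_map (μ := P) hY.aemeasurable
  have := Measure.isProbabilityMeasure_map (μ := P) hXY.aemeasurable
  have htv : ∀ C, MeasurableSet C → |(P.map fun ω => (X ω, Y ω)).real C -
      ((P.map X).prod (P.map Y)).real C| ≤ ε := by
    intro C hC
    refine abs_measureReal_sub_prod_le _ _ _ (fun A D hA hD => ?_) hC
    rw [map_measureReal_apply hXY (hA.prod hD), map_measureReal_apply hX' hA,
      map_measureReal_apply hY hD]
    exact abs_measureReal_inter_sub_le_of_phiCoeff h𝓑 hε h (hY𝓐 _ ⟨D, hD, rfl⟩) (hX hA)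
  have key := integral_sub_integral_le _ _ htv hf
    ((memLp_map_measure_iff hf.aestronglyMeasurable hXY.aemeasurable).2 hL) hL' (κ := κ)
    (by rw [integral_map hXY.aemeasurable (hf.pow_const 2).aestronglyMeasurable]; exact hκ) hκ'
  rw [integral_map hXY.aemeasurable hf.aestronglyMeasurable] at key
  linarith

/-! ### Almost sure convergence of series with summable conditional means -/

/-- Duality between `L¹` and `L∞`: the sign of the conditional expectation is itself an admissible
test function. This reduces conditional means to the decoupling inequality. -/
theorem integral_abs_condExp_le_of_forall {Ω : Type*} {m mΩ : MeasurableSpace Ω} {P : Measure Ω}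
    [IsProbabilityMeasure P] (hm : m ≤ mΩ) {x : Ω → ℝ} (hx : Integrable x P) {b : ℝ}
    (h : ∀ s : Ω → ℝ, Measurable[m] s → (∀ ω, |s ω| ≤ 1) → ∫ ω, s ω * x ω ∂P ≤ b) :
    ∫ ω, |(P[x|m]) ω| ∂P ≤ b := by
  set y := P[x|m] with hy
  have hym : Measurable[m] y := stronglyMeasurable_condExp.measurable
  set s : Ω → ℝ := fun ω => if 0 ≤ y ω then 1 else -1 with hs
  have hsm : Measurable[m] s :=
    Measurable.ite (measurableSet_le measurable_const hym) measurable_const measurable_const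
  have hsb : ∀ ω, |s ω| ≤ 1 := fun ω => by
    simp only [hs]; split_ifs <;> simp
  have hpull := condExp_stronglyMeasurable_mul_of_bound hm hsm.stronglyMeasurable hx 1
    (ae_of_all _ hsb)
  calc ∫ ω, |y ω| ∂P = ∫ ω, (s * y) ω ∂P := by
        refine integral_congr_ae (ae_of_all _ fun ω => ?_)
        simp only [hs, Pi.mul_apply]
        split_ifs with h0
        · rw [abs_of_nonneg h0, one_mul]
        · rw [abs_of_neg (not_le.1 h0), neg_one_mul]
    _ = ∫ ω, (P[s * x|m]) ω ∂P := (integral_congr_ae hpull).symm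
    _ = ∫ ω, s ω * x ω ∂P := integral_condExp hm
    _ ≤ b := h s hsm hsb

/-- Tonelli: the sum has finite expectation, hence is finite almost surely. -/
theorem ae_summable_of_summable_integral {Ω : Type*} [MeasurableSpace Ω] {P : Measure Ω}
    {f : ℕ → Ω → ℝ} (h0 : ∀ k ω, 0 ≤ f k ω) (hi : ∀ k, Integrable (f k) P)
    (hs : Summable fun k => ∫ ω, f k ω ∂P) : ∀ᵐ ω ∂P, Summable fun k => f k ω := by
  have h1 : ∫⁻ ω, ∑' k, ENNReal.ofReal (f k ω) ∂P ≠ ∞ := by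
    rw [lintegral_tsum fun k => (hi k).aestronglyMeasurable.aemeasurable.ennreal_ofReal]
    simp_rw [← ofReal_integral_eq_lintegral_ofReal (hi _) (ae_of_all _ (h0 _))]
    exact hs.tsum_ofReal_ne_top
  have h2 := ae_lt_top' (AEMeasurable.tsum fun k =>
    (hi k).aestronglyMeasurable.aemeasurable.ennreal_ofReal) h1
  filter_upwards [h2] with ω hω
  have := ENNReal.summable_toReal hω.ne
  simpa [ENNReal.toReal_ofReal (h0 _ _)] using this

/-- A series whose conditional means are summable in `L¹` and whose terms are square summable in
`L²` converges almost surely. -/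
theorem ae_exists_tendsto_sum {Ω : Type*} {mΩ : MeasurableSpace Ω} {P : Measure Ω}
    [IsProbabilityMeasure P] (ℱ : Filtration ℕ mΩ) {x : ℕ → Ω → ℝ}
    (hx : ∀ k, StronglyMeasurable[ℱ (k + 1)] (x k)) (hL : ∀ k, MemLp (x k) 2 P)
    (hsq : Summable fun k => ∫ ω, x k ω ^ 2 ∂P)
    (hb : Summable fun k => ∫ ω, |(P[x k|ℱ k]) ω| ∂P) :
    ∀ᵐ ω ∂P, ∃ c, Tendsto (fun n => ∑ k ∈ Finset.range n, x k ω) atTop (𝓝 c) := by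
  set y : ℕ → Ω → ℝ := fun k => P[x k|ℱ k] with hy
  have hyL : ∀ k, MemLp (y k) 2 P := fun k => (hL k).condExp one_le_two
  have hxi : ∀ k, Integrable (x k) P := fun k => (hL k).integrable one_le_two
  -- Doob decomposition: `d` is a martingale difference, bounded in `L²` through conditional Jensen,
  -- and `y` is almost surely absolutely summable.
  set d : ℕ → Ω → ℝ := fun k => x k - y k with hd
  have hdL : ∀ k, MemLp (d k) 2 P := fun k => (hL k).sub (hyL k)
  have hdi : ∀ k, Integrable (d k) P := fun k => (hdL k).integrable one_le_two
  have hdm : ∀ k, StronglyMeasurable[ℱ (k + 1)] (d k) := fun k =>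
    (hx k).sub (stronglyMeasurable_condExp.mono (ℱ.mono (Nat.le_succ k)))
  have hd0 : ∀ k, P[d k|ℱ k] =ᵐ[P] 0 := by
    intro k
    refine (condExp_sub (hxi k) integrable_condExp _).trans ?_
    rw [condExp_of_stronglyMeasurable (ℱ.le k) stronglyMeasurable_condExp integrable_condExp]
    simp
  have hdsq : ∀ k, ∫ ω, d k ω ^ 2 ∂P ≤ 4 * ∫ ω, x k ω ^ 2 ∂P := by
    intro k
    have h1 : ∫ ω, y k ω ^ 2 ∂P ≤ ∫ ω, x k ω ^ 2 ∂P := by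
      have hi : Integrable (fun ω => ‖x k ω‖ ^ (2 : ℝ)) P := by
        simpa using (hL k).integrable_sq
      have := integral_norm_condExp_rpow_le (m := ℱ k) (μ := P) one_le_two
        hi
      simpa using this
    calc ∫ ω, d k ω ^ 2 ∂P ≤ ∫ ω, (2 * x k ω ^ 2 + 2 * y k ω ^ 2) ∂P := by
          refine integral_mono (hdL k).integrable_sq
            (((hL k).integrable_sq.const_mul 2).add ((hyL k).integrable_sq.const_mul 2))
            fun ω => ?_
          simp only [hd, Pi.sub_apply]
          nlinarith [sq_nonneg (x k ω + y k ω)]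
      _ = 2 * ∫ ω, x k ω ^ 2 ∂P + 2 * ∫ ω, y k ω ^ 2 ∂P := by
          rw [integral_add ((hL k).integrable_sq.const_mul 2)
            ((hyL k).integrable_sq.const_mul 2), integral_const_mul, integral_const_mul]
      _ ≤ _ := by linarith
  set N : ℕ → Ω → ℝ := fun n => ∑ k ∈ Finset.range n, d k with hN
  have hNs : ∀ n, N (n + 1) = N n + d n := fun n => Finset.sum_range_succ _ _
  have hNm : ∀ n, StronglyMeasurable[ℱ n] (N n) := fun n =>
    Finset.stronglyMeasurable_sum _ fun k hk =>
      (hdm k).mono (ℱ.mono (Finset.mem_range.1 hk))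
  have hNL : ∀ n, MemLp (N n) 2 P := fun n => memLp_finsetSum' _ fun k _ => hdL k
  have hNi : ∀ n, Integrable (N n) P := fun n => (hNL n).integrable one_le_two
  have hmart : Martingale N ℱ P := by
    refine martingale_nat hNm hNi fun n => ?_
    rw [hNs]
    refine EventuallyEq.symm ((condExp_add (hNi n) (hdi n) _).trans ?_)
    rw [condExp_of_stronglyMeasurable (ℱ.le n) (hNm n) (hNi n)]
    filter_upwards [hd0 n] with ω hω
    simp [hω]
  -- Orthogonality of increments makes the second moments of `N` add up, so `N` is bounded in `L²`,
  -- hence in `L¹`, and Doob's convergence theorem applies.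
  have horth : ∀ n, ∫ ω, N n ω * d n ω ∂P = 0 := by
    intro n
    have hmul : Integrable (N n * d n) P := (hNL n).integrable_mul (hdL n)
    have h1 := condExp_mul_of_stronglyMeasurable_left (hNm n) hmul (hdi n)
    calc _ = ∫ ω, (P[N n * d n|ℱ n]) ω ∂P := (integral_condExp (ℱ.le n)).symm
      _ = ∫ ω, (0 : ℝ) ∂P := by
          refine integral_congr_ae ?_
          filter_upwards [h1, hd0 n] with ω h1 h2
          simp [h1, h2]
      _ = 0 := integral_zero _ _
  have hNsq : ∀ n, ∫ ω, N n ω ^ 2 ∂P ≤ 4 * ∑ k ∈ Finset.range n, ∫ ω, x k ω ^ 2 ∂P := by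
    intro n
    induction n with
    | zero => simp [hN]
    | succ n ih =>
      have : ∫ ω, N (n + 1) ω ^ 2 ∂P = ∫ ω, N n ω ^ 2 ∂P + ∫ ω, d n ω ^ 2 ∂P := by
        have hmul : Integrable (fun ω => N n ω * d n ω) P := (hNL n).integrable_mul (hdL n)
        have : ∀ ω, N (n + 1) ω ^ 2 = N n ω ^ 2 + d n ω ^ 2 + 2 * (N n ω * d n ω) := by
          intro ω; rw [hNs]; simp only [Pi.add_apply]; ring
        simp_rw [this]
        rw [integral_add (f := fun ω => N n ω ^ 2 + d n ω ^ 2)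
            ((hNL n).integrable_sq.add (hdL n).integrable_sq) (hmul.const_mul 2),
          integral_add (hNL n).integrable_sq (hdL n).integrable_sq, integral_const_mul, horth]
        ring
      rw [this, Finset.sum_range_succ]
      linarith [hdsq n]
  have hbdd : ∀ n, eLpNorm (N n) 1 P ≤
      ((1 + 4 * ∑' k, ∫ ω, x k ω ^ 2 ∂P).toNNReal : ℝ≥0∞) := by
    intro n
    have h0 : ∀ k, 0 ≤ ∫ ω, x k ω ^ 2 ∂P := fun k => integral_nonneg fun ω => sq_nonneg _
    rw [eLpNorm_one_eq_lintegral_enorm, ← ofReal_integral_norm_eq_lintegral_enorm (hNi n)]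
    refine ENNReal.ofReal_le_ofReal ?_
    calc ∫ ω, ‖N n ω‖ ∂P ≤ ∫ ω, (1 + N n ω ^ 2) ∂P := by
          refine integral_mono (hNi n).norm ((integrable_const _).add (hNL n).integrable_sq)
            fun ω => ?_
          simp only [Real.norm_eq_abs]
          nlinarith [sq_nonneg (|N n ω| - 1), sq_abs (N n ω), abs_nonneg (N n ω)]
      _ = 1 + ∫ ω, N n ω ^ 2 ∂P := by
          rw [integral_add (integrable_const _) (hNL n).integrable_sq]; simp
      _ ≤ _ := by
          have := hsq.sum_le_tsum (Finset.range n) fun k _ => h0 k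
          linarith [hNsq n]
  have hsum := ae_summable_of_summable_integral (P := P) (f := fun k ω => |y k ω|)
    (fun _ _ => abs_nonneg _) (fun k => ((hyL k).integrable one_le_two).abs) hb
  filter_upwards [hmart.submartingale.exists_ae_tendsto_of_bdd hbdd, hsum] with ω ⟨c, hc⟩ hω
  refine ⟨c + ∑' k, y k ω, ?_⟩
  refine (hc.add hω.of_abs.hasSum.tendsto_sum_nat).congr fun n => ?_
  simp only [hN, Finset.sum_apply, ← Finset.sum_add_distrib]
  exact Finset.sum_congr rfl fun k _ => by simp [hd]

/-! ### Deterministic ingredients -/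

/-- Deterministic Robbins–Siegmund lemma with a convergent (signed) series of errors. -/
theorem tendsto_zero_of_recursive_le {V a e : ℕ → ℝ} (hV : ∀ k, 0 ≤ V k) (ha : ∀ k, 0 ≤ a k)
    (hrec : ∀ k, V (k + 1) ≤ V k - a k * V k + e k) {c : ℝ}
    (he : Tendsto (fun n => ∑ k ∈ Finset.range n, e k) atTop (𝓝 c)) (hsum : ¬ Summable a) :
    Tendsto V atTop (𝓝 0) := by
  set E : ℕ → ℝ := fun n => ∑ k ∈ Finset.range n, e k with hE
  -- Removing the accumulated errors leaves a nonincreasing sequence, bounded below because the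
  -- partial sums of `e` are bounded above. So `V` has a limit.
  set W : ℕ → ℝ := fun n => V n - E n with hW
  have hstep : ∀ n, W (n + 1) ≤ W n - a n * V n := by
    intro n
    have : E (n + 1) = E n + e n := Finset.sum_range_succ _ _
    simp only [hW, this]
    linarith [hrec n]
  have hanti : Antitone W := antitone_nat_of_succ_le fun n =>
    (hstep n).trans (by linarith [mul_nonneg (ha n) (hV n)])
  obtain ⟨R, hR⟩ := he.bddAbove_range
  have hWlow : ∀ n, -R ≤ W n := fun n => by
    have : E n ≤ R := hR ⟨n, rfl⟩
    simp only [hW]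
    linarith [hV n]
  have hWlim : Tendsto W atTop (𝓝 (⨅ n, W n)) :=
    tendsto_atTop_ciInf hanti ⟨-R, by rintro _ ⟨n, rfl⟩; exact hWlow n⟩
  set v := (⨅ n, W n) + c with hv
  have hVlim : Tendsto V atTop (𝓝 v) := (hWlim.add he).congr fun n => by simp [hW]
  have hpartial : ∀ n, ∑ k ∈ Finset.range n, a k * V k ≤ W 0 - W n := by
    intro n
    induction n with
    | zero => simp
    | succ n ih => rw [Finset.sum_range_succ]; linarith [hstep n]
  have haV : Summable fun k => a k * V k :=
    summable_of_sum_range_le (c := W 0 + R) (fun k => mul_nonneg (ha k) (hV k)) fun n =>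
      (hpartial n).trans (by linarith [hWlow n])
  have hv0 : 0 ≤ v := ge_of_tendsto' hVlim hV
  rcases hv0.eq_or_lt with h0 | h0
  · rwa [← h0] at hVlim
  · refine absurd ?_ hsum
    -- If the limit were positive, `a k ≤ (2 / v) * (a k * V k)` eventually, and `a` would be
    -- summable.
    have hev : ∀ᶠ k in atTop, v / 2 < V k := hVlim.eventually_const_lt (by linarith)
    refine Summable.of_norm_bounded_eventually_nat (haV.mul_left (2 / v)) ?_
    filter_upwards [hev] with k hk
    rw [Real.norm_of_nonneg (ha k)]
    have : 1 ≤ 2 / v * V k := by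
      rw [div_mul_eq_mul_div, le_div_iff₀ h0]; linarith
    nlinarith [ha k]

/-! ### Euclidean projection, and the drift from strong convexity. -/

section Projection

variable {d : ℕ} {Θ : Set (EuclideanSpace ℝ (Fin d))}

theorem inner_sub_projOn_le (hΘ : IsCompact Θ) (hc : Convex ℝ Θ) (hne : Θ.Nonempty)
    (x : EuclideanSpace ℝ (Fin d)) {w : EuclideanSpace ℝ (Fin d)} (hw : w ∈ Θ) :
    inner ℝ (x - projOn Θ x) (w - projOn Θ x) ≤ 0 := by
  obtain ⟨hmem, hmin⟩ := projOn_spec hΘ hne x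
  refine (norm_eq_iInf_iff_real_inner_le_zero hc hmem).1 ?_ w hw
  have : Nonempty Θ := hne.to_subtype
  refine le_antisymm (le_ciInf fun w => ?_) ?_
  · simpa [dist_eq_norm] using hmin w w.2
  · exact ciInf_le (f := fun w : Θ => ‖x - w‖)
      ⟨0, by rintro _ ⟨w, rfl⟩; exact norm_nonneg _⟩ ⟨_, hmem⟩

theorem norm_projOn_sub_projOn_le (hΘ : IsCompact Θ) (hc : Convex ℝ Θ) (hne : Θ.Nonempty)
    (x y : EuclideanSpace ℝ (Fin d)) : ‖projOn Θ x - projOn Θ y‖ ≤ ‖x - y‖ := by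
  have h1 := inner_sub_projOn_le hΘ hc hne x (projOn_spec hΘ hne y).1
  have h2 := inner_sub_projOn_le hΘ hc hne y (projOn_spec hΘ hne x).1
  set u := projOn Θ x
  set v := projOn Θ y
  -- Adding the two variational inequalities gives `‖u - v‖² ≤ ⟨x - y, u - v⟩`; Cauchy–Schwarz does
  -- the rest.
  have h3 : inner ℝ (x - u) (v - u) + inner ℝ (y - v) (u - v)
      = inner ℝ (u - v) (u - v) - inner ℝ (x - y) (u - v) := by
    rw [show v - u = -(u - v) by abel, inner_neg_right, ← inner_neg_left, ← inner_add_left,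
      ← inner_sub_left]
    congr 1; abel
  rw [real_inner_self_eq_norm_sq] at h3
  have h4 := real_inner_le_norm (x - y) (u - v)
  by_contra! h
  nlinarith [norm_nonneg (x - y), norm_nonneg (u - v)]

theorem projOn_eq_self (hΘ : IsCompact Θ) {w : EuclideanSpace ℝ (Fin d)} (hw : w ∈ Θ) :
    projOn Θ w = w := by
  have := (projOn_spec hΘ ⟨w, hw⟩ w).2 w hw
  rw [dist_self] at this
  exact (dist_le_zero.1 this).symm

theorem norm_projOn_sub_le (hΘ : IsCompact Θ) (hc : Convex ℝ Θ)
    (x : EuclideanSpace ℝ (Fin d)) {w : EuclideanSpace ℝ (Fin d)} (hw : w ∈ Θ) :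
    ‖projOn Θ x - w‖ ≤ ‖x - w‖ := by
  simpa [projOn_eq_self hΘ hw] using norm_projOn_sub_projOn_le hΘ hc ⟨w, hw⟩ x w

theorem measurable_projOn (hΘ : IsCompact Θ) (hc : Convex ℝ Θ) (hne : Θ.Nonempty) :
    Measurable (projOn Θ) := by
  have : LipschitzWith 1 (projOn Θ) := LipschitzWith.of_dist_le_mul fun x y => by
    simpa [dist_eq_norm] using norm_projOn_sub_projOn_le hΘ hc hne x y
  exact this.continuous.measurable

/-- The midpoint of `θ` and the minimizer gives growth `f θ - f θs ≥ (m/4) ‖θ - θs‖²`, and the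
tangent inequality at `θ` bounds that growth by the inner product. As `θ` may be a boundary point,
only the one-sided derivative along the segment towards `θs` is used. -/
theorem inner_gradientWithin_ge_of_strongConvexOn {f : EuclideanSpace ℝ (Fin d) → ℝ} {m : ℝ}
    (hf : StrongConvexOn Θ m f) (hm : 0 ≤ m) {θs θ : EuclideanSpace ℝ (Fin d)} (hs : θs ∈ Θ)
    (hmin : IsMinOn f Θ θs) (hθ : θ ∈ Θ) (hd : DifferentiableWithinAt ℝ f Θ θ) :
    m / 4 * ‖θ - θs‖ ^ 2 ≤ inner ℝ (gradientWithin f Θ θ) (θ - θs) := by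
  obtain ⟨hc, hf⟩ := hf
  have hgrowth : m / 4 * ‖θ - θs‖ ^ 2 ≤ f θ - f θs := by
    have h1 := hf hθ hs (a := 1 / 2) (b := 1 / 2) (by norm_num) (by norm_num) (by norm_num)
    have h2 : f θs ≤ f ((1 / 2 : ℝ) • θ + (1 / 2 : ℝ) • θs) :=
      hmin (hc hθ hs (by norm_num) (by norm_num) (by norm_num))
    simp only [smul_eq_mul] at h1
    linarith
  set u := θs - θ with hu
  set c : ℝ → EuclideanSpace ℝ (Fin d) := fun t => θ + t • u with hcdef
  have hmem : ∀ t ∈ Icc (0 : ℝ) 1, c t ∈ Θ := fun t ht => hc.add_smul_sub_mem hθ hs ht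
  have hder : HasDerivWithinAt (fun t => f (c t)) (inner ℝ (gradientWithin f Θ θ) u)
      (Icc 0 1) 0 := by
    have hg := hd.hasGradientWithinAt.hasFDerivWithinAt
    have hc' : HasDerivWithinAt c u (Icc 0 1) 0 := by
      simpa [hcdef] using (((hasDerivAt_id (0 : ℝ)).smul_const u).const_add θ).hasDerivWithinAt
    have h0 : c 0 = θ := by simp [hcdef]
    rw [← h0] at hg
    have := hg.comp_hasDerivWithinAt (0 : ℝ) hc' hmem
    rw [h0] at this
    simpa [Function.comp_def] using this
  have hslope : inner ℝ (gradientWithin f Θ θ) u ≤ f θs - f θ := by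
    rw [hasDerivWithinAt_iff_tendsto_slope] at hder
    have hset : Icc (0 : ℝ) 1 \ {0} = Ioc 0 1 := by ext; simp [lt_iff_le_and_ne, eq_comm]
    rw [hset] at hder
    have : (𝓝[Ioc (0 : ℝ) 1] 0).NeBot := by
      rw [nhdsWithin_Ioc_eq_nhdsGT one_pos]; infer_instance
    refine le_of_tendsto hder (eventually_nhdsWithin_of_forall fun t ht => ?_)
    have h1 := hf hθ hs (a := 1 - t) (b := t) (by linarith [ht.2]) ht.1.le (by ring)
    have h2 : (1 - t) • θ + t • θs = c t := by simp only [hcdef, hu]; module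
    have h3 : 0 ≤ (1 - t) * t * (m / 2 * ‖θ - θs‖ ^ 2) :=
      mul_nonneg (mul_nonneg (by linarith [ht.2]) ht.1.le) (by positivity)
    have h0 : c 0 = θ := by simp [hcdef]
    rw [h2] at h1
    simp only [smul_eq_mul] at h1
    rw [slope_def_field, h0, sub_zero, div_le_iff₀ ht.1]
    linarith
  have : inner ℝ (gradientWithin f Θ θ) (θ - θs) = -inner ℝ (gradientWithin f Θ θ) u := by
    rw [← inner_neg_right, hu, neg_sub]
  linarith

end Projection

/-! ### Summability of step sizes and mixing rates. -/

section Rates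

theorem learningRate_pos {γ ρ : ℝ} (hγ : 0 < γ) (t : ℕ) : 0 < learningRate γ ρ t := by
  unfold learningRate; positivity

theorem learningRate_le_rpow {γ ρ : ℝ} (hγ : 0 < γ) (hρ : 0 < ρ) (t : ℕ) :
    learningRate γ ρ (t + 1) ≤ ((t : ℝ) + 1) ^ (-ρ) := by
  unfold learningRate
  push_cast
  exact Real.rpow_le_rpow_of_nonpos (by positivity) (by linarith) (by linarith)

theorem summable_learningRate_sq {γ ρ : ℝ} (hγ : 0 < γ) (hρ : 1 / 2 < ρ) :
    Summable fun k : ℕ => learningRate γ ρ (k + 2) ^ 2 := by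
  have h1 : Summable fun n : ℕ => ((n : ℝ)) ^ (-(2 * ρ)) :=
    Real.summable_nat_rpow.2 (by linarith)
  refine Summable.of_nonneg_of_le (fun k => sq_nonneg _) (fun k => ?_)
    ((summable_nat_add_iff 2).2 h1)
  have h2 : learningRate γ ρ (k + 2) ≤ ((k + 2 : ℕ) : ℝ) ^ (-ρ) := by
    have := learningRate_le_rpow (ρ := ρ) hγ (by linarith) (k + 1)
    push_cast at this ⊢
    rwa [show (k : ℝ) + 2 = k + 1 + 1 by ring]
  calc _ ≤ (((k + 2 : ℕ) : ℝ) ^ (-ρ)) ^ 2 :=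
        pow_le_pow_left₀ (learningRate_pos hγ _).le h2 2
    _ = _ := by
        rw [← Real.rpow_natCast, ← Real.rpow_mul (by positivity)]
        congr 1; push_cast; ring

theorem not_summable_learningRate {γ ρ : ℝ} (hγ : 0 < γ) (hρ : 0 < ρ) (hρ1 : ρ < 1) :
    ¬ Summable fun k : ℕ => learningRate γ ρ (k + 2) := by
  intro h
  obtain ⟨N, hN⟩ := exists_nat_ge γ
  have h1 : ¬ Summable fun n : ℕ => ((n : ℝ)) ^ (-ρ) := by
    rw [Real.summable_nat_rpow]; linarith
  refine h1 ((summable_nat_add_iff (N + 2)).1 ?_)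
  refine Summable.of_nonneg_of_le (fun k => by positivity) (fun k => ?_) h
  unfold learningRate
  refine Real.rpow_le_rpow_of_nonpos (by positivity) ?_ (by linarith)
  push_cast; linarith

variable {φ : ℕ → ℝ} {B : ℕ → ℕ} {p γ ρ : ℝ}

theorem nonneg_of_antitoneOn_tendsto_zero (ha : AntitoneOn φ (Ici 1))
    (h0 : Tendsto φ atTop (𝓝 0)) {t : ℕ} (ht : 1 ≤ t) : 0 ≤ φ t := by
  refine le_of_tendsto h0 ?_
  filter_upwards [eventually_ge_atTop t] with s hs
  exact ha ht (ht.trans hs) hs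

/-- Eventually `φ (B t) ≤ 1`, and then lowering the exponent from `1/2` to `1/2 - 1/p > 0` only
increases the power. -/
theorem RateAssumptions.summable_learningRate_mul_sqrt (hrate : RateAssumptions φ B p γ ρ)
    (hp : 2 < p) (ha : AntitoneOn φ (Ici 1)) (h0 : Tendsto φ atTop (𝓝 0)) :
    Summable fun k : ℕ => learningRate γ ρ (k + 2) * √(φ (B (k + 1))) := by
  have hρ : 0 < ρ := by linarith [hrate.half_lt_ρ]
  refine Summable.of_norm_bounded_eventually_nat hrate.summable_batch ?_
  have hB : Tendsto (fun k => φ (B (k + 1))) atTop (𝓝 0) :=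
    h0.comp (hrate.batch_tendsto.comp (tendsto_add_atTop_nat 1))
  filter_upwards [hB.eventually_le_const one_pos] with k hk
  have hφ : 0 ≤ φ (B (k + 1)) :=
    nonneg_of_antitoneOn_tendsto_zero ha h0 (hrate.batch_pos _ (by omega))
  have hexp : 0 < 1 / 2 - 1 / p := by
    have : 1 / p < 1 / 2 := one_div_lt_one_div_of_lt two_pos hp
    linarith
  have h1 : √(φ (B (k + 1))) ≤ φ (B (k + 1)) ^ ((1 : ℝ) / 2 - 1 / p) := by
    rw [Real.sqrt_eq_rpow]
    have : 0 < 1 / p := by positivity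
    exact Real.rpow_le_rpow_of_exponent_ge' hφ hk hexp.le (by linarith)
  have h2 : learningRate γ ρ (k + 2) ≤ ((k + 1 : ℕ) : ℝ) ^ (-ρ) := by
    have := hrate.γ_pos
    unfold learningRate
    push_cast
    exact Real.rpow_le_rpow_of_nonpos (by positivity) (by linarith) (by linarith)
  rw [Real.norm_of_nonneg (mul_nonneg (learningRate_pos hrate.γ_pos _).le (Real.sqrt_nonneg _))]
  exact mul_le_mul h2 h1 (Real.sqrt_nonneg _) (by positivity)

end Rates

/-! ### The stochastic recursion -/

theorem Stationary.map_eq {Ω 𝒵 : Type*} [MeasurableSpace Ω] [MeasurableSpace 𝒵] {P : Measure Ω}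
    {Z : ℕ → Ω → 𝒵} (hZ : ∀ t, 1 ≤ t → Measurable (Z t)) (hs : Stationary P Z) {i : ℕ}
    (hi : 1 ≤ i) : P.map (Z i) = P.map (Z 1) := by
  have hm : ∀ h, Measurable fun ω (j : ℕ) => Z (j + 1 + h) ω := fun h =>
    measurable_pi_lambda _ fun j => hZ _ (by omega)
  have h1 := congrArg (Measure.map fun f : ℕ → 𝒵 => f 0) (hs (i - 1))
  rw [Measure.map_map (measurable_pi_apply 0) (hm _),
    Measure.map_map (measurable_pi_apply 0) (hm 0)] at h1
  have e : 0 + 1 + (i - 1) = i := by omega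
  simpa [Function.comp_def, e] using h1

theorem measurable_sigmaGen {Ω 𝒵 : Type*} [MeasurableSpace 𝒵] (Z : ℕ → Ω → 𝒵) {S : Set ℕ} {i : ℕ}
    (hi : i ∈ S) : Measurable[sigmaGen Z S] (Z i) :=
  measurable_iff_comap_le.2 (le_iSup₂_of_le i hi le_rfl)

theorem sigmaGen_mono {Ω 𝒵 : Type*} [MeasurableSpace 𝒵] (Z : ℕ → Ω → 𝒵) {S T : Set ℕ}
    (h : S ⊆ T) : sigmaGen Z S ≤ sigmaGen Z T :=
  iSup₂_le fun i hi => le_iSup₂_of_le i (h hi) le_rfl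

/-! ### Measurability of the iterates and of the gradient noise. -/

section Measurability

variable {Ω 𝒵 : Type*} [mΩ : MeasurableSpace Ω] [MeasurableSpace 𝒵] {d : ℕ}
  {Θ : Set (EuclideanSpace ℝ (Fin d))}
  {H : 𝒵 → EuclideanSpace ℝ (Fin d) → EuclideanSpace ℝ (Fin d)}

/-- The σ-algebra on `Ω` is arbitrary; taking the one generated by the past yields adaptedness of
the iterates. -/
theorem measurable_sgd (hH : Measurable (Function.uncurry H)) (hproj : Measurable (projOn Θ))
    (γ : ℕ → ℝ) (B : ℕ → ℕ) (blk : ℕ → Finset ℕ) (θ₀ : EuclideanSpace ℝ (Fin d))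
    {Z : ℕ → Ω → 𝒵} (t : ℕ) (hZ : ∀ s, 1 ≤ s → s ≤ t → ∀ i ∈ blk s, Measurable (Z i)) :
    Measurable fun ω => sgd Θ H γ B blk θ₀ (fun i => Z i ω) t := by
  induction t with
  | zero => exact measurable_const
  | succ t ih =>
    have ht := ih fun s h1 h2 => hZ s h1 (by omega)
    have hsum : Measurable fun ω => ∑ i ∈ blk (t + 1),
        H (Z i ω) (sgd Θ H γ B blk θ₀ (fun i => Z i ω) t) := by
      refine Finset.measurable_fun_sum _ fun i hi => ?_
      exact hH.comp ((hZ (t + 1) (by omega) le_rfl i hi).prodMk ht)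
    exact hproj.comp (ht.sub ((hsum.const_smul (1 / (B (t + 1) : ℝ))).const_smul (γ (t + 1))))

/-- `⟨θ - θ*, ∇l(z, θ) - E ∇l(Z, θ)⟩`: the effect of the gradient noise on the squared error. -/
noncomputable def gradNoise (μ : Measure 𝒵)
    (H : 𝒵 → EuclideanSpace ℝ (Fin d) → EuclideanSpace ℝ (Fin d))
    (θs : EuclideanSpace ℝ (Fin d)) (q : EuclideanSpace ℝ (Fin d) × 𝒵) : ℝ :=
  inner ℝ (q.1 - θs) (H q.2 q.1 - ∫ z, H z q.1 ∂μ)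

theorem measurable_gradNoise (hH : Measurable (Function.uncurry H)) (μ : Measure 𝒵)
    [SFinite μ] (θs : EuclideanSpace ℝ (Fin d)) : Measurable (gradNoise μ H θs) := by
  have hsw : Measurable fun q : EuclideanSpace ℝ (Fin d) × 𝒵 => H q.2 q.1 :=
    hH.comp measurable_swap
  have hint : Measurable fun θ : EuclideanSpace ℝ (Fin d) => ∫ z, H z θ ∂μ :=
    (StronglyMeasurable.integral_prod_right' (ν := μ) hsw.stronglyMeasurable).measurable
  exact (measurable_fst.sub_const θs).inner (hsw.sub (hint.comp measurable_fst))

end Measurability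

/-! ### Moments and near-centering of the gradient noise. -/

section Noise

variable {Ω 𝒵 : Type*} [MeasurableSpace 𝒵] {d : ℕ}
  {Θ : Set (EuclideanSpace ℝ (Fin d))} {θs : EuclideanSpace ℝ (Fin d)}
  {H : 𝒵 → EuclideanSpace ℝ (Fin d) → EuclideanSpace ℝ (Fin d)}
  {μ : Measure 𝒵} [IsProbabilityMeasure μ] {w : 𝒵 → ℝ} {D : ℝ}

theorem integrable_grad (hH : Measurable (Function.uncurry H)) (hw : Integrable w μ)
    (hHw : ∀ᵐ z ∂μ, ∀ θ ∈ Θ, ‖H z θ‖ ^ 2 ≤ w z) {θ : EuclideanSpace ℝ (Fin d)} (hθ : θ ∈ Θ) :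
    Integrable (fun z => H z θ) μ := by
  have hm : Measurable fun z => H z θ := hH.comp (measurable_id.prodMk measurable_const)
  refine Integrable.mono' ((integrable_const 1).add hw) hm.aestronglyMeasurable ?_
  filter_upwards [hHw] with z hz
  simp only [Pi.add_apply]
  nlinarith [hz θ hθ, sq_nonneg (‖H z θ‖ - 1), norm_nonneg (H z θ)]

theorem norm_integral_grad_le (hw : Integrable w μ)
    (hHw : ∀ᵐ z ∂μ, ∀ θ ∈ Θ, ‖H z θ‖ ^ 2 ≤ w z) {θ : EuclideanSpace ℝ (Fin d)} (hθ : θ ∈ Θ) :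
    ‖∫ z, H z θ ∂μ‖ ≤ ∫ z, (1 + w z) ∂μ := by
  refine norm_integral_le_of_norm_le ((integrable_const 1).add hw) ?_
  filter_upwards [hHw] with z hz
  nlinarith [hz θ hθ, sq_nonneg (‖H z θ‖ - 1), norm_nonneg (H z θ)]

/-- An integrable envelope of the squared gradient noise. -/
noncomputable def noiseEnvelope (μ : Measure 𝒵) (w : 𝒵 → ℝ) (D : ℝ) (z : 𝒵) : ℝ :=
  D ^ 2 * (2 * w z + 2 * (∫ z, (1 + w z) ∂μ) ^ 2)

theorem integrable_noiseEnvelope (hw : Integrable w μ) : Integrable (noiseEnvelope μ w D) μ :=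
  ((hw.const_mul 2).add (integrable_const _)).const_mul _

/-- One exceptional null set serves all `θ` at once, which is what permits substituting a random
iterate for `θ`. -/
theorem ae_gradNoise_sq_le (hw : Integrable w μ)
    (hHw : ∀ᵐ z ∂μ, ∀ θ ∈ Θ, ‖H z θ‖ ^ 2 ≤ w z) (hD : ∀ θ ∈ Θ, ‖θ - θs‖ ≤ D) :
    ∀ᵐ z ∂μ, ∀ θ ∈ Θ, gradNoise μ H θs (θ, z) ^ 2 ≤ noiseEnvelope μ w D z := by
  filter_upwards [hHw] with z hz θ hθ
  have h1 := norm_integral_grad_le hw hHw hθ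
  set g := ∫ z, H z θ ∂μ
  set c := ∫ z, (1 + w z) ∂μ
  have h2 : ‖H z θ - g‖ ^ 2 ≤ 2 * w z + 2 * c ^ 2 := by
    have h3 : ‖g‖ ^ 2 ≤ c ^ 2 := pow_le_pow_left₀ (norm_nonneg _) h1 2
    have h4 : ‖H z θ - g‖ ^ 2 ≤ (‖H z θ‖ + ‖g‖) ^ 2 :=
      pow_le_pow_left₀ (norm_nonneg _) (norm_sub_le _ _) 2
    nlinarith [hz θ hθ, sq_nonneg (‖H z θ‖ - ‖g‖)]
  calc gradNoise μ H θs (θ, z) ^ 2 ≤ (‖θ - θs‖ * ‖H z θ - g‖) ^ 2 :=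
        sq_le_sq' (neg_le_of_abs_le (abs_real_inner_le_norm _ _)) (real_inner_le_norm _ _)
    _ = ‖θ - θs‖ ^ 2 * ‖H z θ - g‖ ^ 2 := mul_pow _ _ _
    _ ≤ D ^ 2 * (2 * w z + 2 * c ^ 2) :=
        mul_le_mul (pow_le_pow_left₀ (norm_nonneg _) (hD θ hθ) 2) h2 (sq_nonneg _) (sq_nonneg _)

theorem integral_gradNoise (hH : Measurable (Function.uncurry H)) (hw : Integrable w μ)
    (hHw : ∀ᵐ z ∂μ, ∀ θ ∈ Θ, ‖H z θ‖ ^ 2 ≤ w z) {θ : EuclideanSpace ℝ (Fin d)} (hθ : θ ∈ Θ) :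
    ∫ z, gradNoise μ H θs (θ, z) ∂μ = 0 := by
  have hi := integrable_grad hH hw hHw hθ
  simp only [gradNoise]
  rw [integral_inner (f := fun z => H z θ - ∫ z, H z θ ∂μ) (hi.sub (integrable_const _)),
    integral_sub hi (integrable_const _)]
  simp

variable {𝓑 𝓐 mΩ : MeasurableSpace Ω} {P : Measure Ω}

/-- The envelope depends on `Y` alone, so only the marginal law of `Y` matters, whatever its
dependence on `X` and `s`. The factor `s` is the test function for conditional means; `s = 1` gives
plain moments. -/
theorem memLp_gradNoise_comp (hH : Measurable (Function.uncurry H)) (hw : Integrable w μ)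
    (hHw : ∀ᵐ z ∂μ, ∀ θ ∈ Θ, ‖H z θ‖ ^ 2 ≤ w z) (hD : ∀ θ ∈ Θ, ‖θ - θs‖ ≤ D)
    {X : Ω → EuclideanSpace ℝ (Fin d)} {Y : Ω → 𝒵} (hX : Measurable X) (hY : Measurable Y)
    (hXΘ : ∀ ω, X ω ∈ Θ) (hYμ : P.map Y = μ) {s : Ω → ℝ} (hs : Measurable s)
    (hs1 : ∀ ω, |s ω| ≤ 1) :
    MemLp (fun ω => s ω * gradNoise μ H θs (X ω, Y ω)) 2 P ∧
      ∫ ω, (s ω * gradNoise μ H θs (X ω, Y ω)) ^ 2 ∂P ≤ ∫ z, noiseEnvelope μ w D z ∂μ := by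
  have hm : Measurable fun ω => s ω * gradNoise μ H θs (X ω, Y ω) :=
    hs.mul ((measurable_gradNoise hH μ θs).comp (hX.prodMk hY))
  have henv := integrable_noiseEnvelope (D := D) hw
  have henv₁ : Integrable (noiseEnvelope μ w D) (P.map Y) := by rwa [hYμ]
  have henv' : Integrable (fun ω => noiseEnvelope μ w D (Y ω)) P := henv₁.comp_measurable hY
  have hb : ∀ᵐ ω ∂P, (s ω * gradNoise μ H θs (X ω, Y ω)) ^ 2 ≤ noiseEnvelope μ w D (Y ω) := by
    have h : ∀ᵐ z ∂P.map Y, ∀ θ ∈ Θ, gradNoise μ H θs (θ, z) ^ 2 ≤ noiseEnvelope μ w D z := by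
      rw [hYμ]; exact ae_gradNoise_sq_le hw hHw hD
    filter_upwards [ae_of_ae_map hY.aemeasurable h] with ω hω
    rw [mul_pow, ← sq_abs (s ω)]
    have h1 : |s ω| ^ 2 ≤ 1 := pow_le_one₀ (abs_nonneg _) (hs1 ω)
    exact (mul_le_of_le_one_left (sq_nonneg _) h1).trans (hω _ (hXΘ ω))
  have hi : Integrable (fun ω => (s ω * gradNoise μ H θs (X ω, Y ω)) ^ 2) P := by
    refine Integrable.mono' henv' (hm.pow_const 2).aestronglyMeasurable ?_
    filter_upwards [hb] with ω hω
    rwa [Real.norm_of_nonneg (sq_nonneg _)]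
  refine ⟨(memLp_two_iff_integrable_sq hm.aestronglyMeasurable).2 hi, ?_⟩
  refine (integral_mono_ae hi henv' hb).trans ?_
  rw [← integral_map (μ := P) hY.aemeasurable henv₁.aestronglyMeasurable, hYμ]

/-- The gradient noise is nearly centered given the past. -/
theorem integral_mul_gradNoise_le [IsProbabilityMeasure P] (h𝓑 : 𝓑 ≤ mΩ)
    (hH : Measurable (Function.uncurry H)) (hΘ : MeasurableSet Θ) (hw : Integrable w μ)
    (hHw : ∀ᵐ z ∂μ, ∀ θ ∈ Θ, ‖H z θ‖ ^ 2 ≤ w z) (hD : ∀ θ ∈ Θ, ‖θ - θs‖ ≤ D)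
    {ε : ℝ} (hε : 0 ≤ ε) (h : phiCoeff P 𝓑 𝓐 ≤ ENNReal.ofReal ε)
    {X : Ω → EuclideanSpace ℝ (Fin d)} {Y : Ω → 𝒵} (hX : Measurable[𝓑] X) (hY : Measurable Y)
    (hY𝓐 : MeasurableSpace.comap Y inferInstance ≤ 𝓐)
    (hXΘ : ∀ ω, X ω ∈ Θ) (hYμ : P.map Y = μ) {s : Ω → ℝ} (hs : Measurable[𝓑] s)
    (hs1 : ∀ ω, |s ω| ≤ 1) :
    ∫ ω, s ω * gradNoise μ H θs (X ω, Y ω) ∂P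
      ≤ (2 + 2 * ∫ z, noiseEnvelope μ w D z ∂μ) * √ε := by
  have hX' : Measurable X := hX.mono h𝓑 le_rfl
  have hs' : Measurable s := hs.mono h𝓑 le_rfl
  have hXs : Measurable[𝓑] fun ω => (X ω, s ω) := hX.prodMk hs
  have hXs' : Measurable fun ω => (X ω, s ω) := hX'.prodMk hs'
  -- The iterate and the test function together play the role of the past variable in the decoupling
  -- inequality.
  set f : (EuclideanSpace ℝ (Fin d) × ℝ) × 𝒵 → ℝ :=
    fun q => q.1.2 * gradNoise μ H θs (q.1.1, q.2) with hf
  have hfm : Measurable f := measurable_fst.snd.mul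
    ((measurable_gradNoise hH μ θs).comp (measurable_fst.fst.prodMk measurable_snd))
  set α := P.map fun ω => (X ω, s ω)
  have hαp : IsProbabilityMeasure α := Measure.isProbabilityMeasure_map hXs'.aemeasurable
  have hα : ∀ᵐ a ∂α, a.1 ∈ Θ ∧ |a.2| ≤ 1 := by
    rw [ae_map_iff hXs'.aemeasurable]
    · exact ae_of_all _ fun ω => ⟨hXΘ ω, hs1 ω⟩
    · exact (measurable_fst hΘ).inter
        (measurableSet_le measurable_snd.abs measurable_const)
  obtain ⟨hL, hκ⟩ := memLp_gradNoise_comp (P := P) hH hw hHw hD hX' hY hXΘ hYμ hs' hs1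
  have henv : Integrable (fun q : (EuclideanSpace ℝ (Fin d) × ℝ) × 𝒵 => noiseEnvelope μ w D q.2)
      (α.prod μ) := (integrable_noiseEnvelope hw).comp_snd α
  have hb : ∀ᵐ q ∂α.prod μ, f q ^ 2 ≤ noiseEnvelope μ w D q.2 := by
    filter_upwards [Measure.quasiMeasurePreserving_fst.ae hα,
      Measure.quasiMeasurePreserving_snd.ae (ae_gradNoise_sq_le hw hHw hD)] with q h1 h2
    have h3 : |q.1.2| ^ 2 ≤ 1 := pow_le_one₀ (abs_nonneg _) h1.2
    rw [hf, mul_pow, ← sq_abs]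
    exact (mul_le_of_le_one_left (sq_nonneg _) h3).trans (h2 _ h1.1)
  have hi : Integrable (fun q => f q ^ 2) (α.prod μ) := by
    refine Integrable.mono' henv (hfm.pow_const 2).aestronglyMeasurable ?_
    filter_upwards [hb] with q hq
    rwa [Real.norm_of_nonneg (sq_nonneg _)]
  have hL' : MemLp f 2 (α.prod μ) := (memLp_two_iff_integrable_sq hfm.aestronglyMeasurable).2 hi
  have hκ' : ∫ q, f q ^ 2 ∂α.prod μ ≤ ∫ z, noiseEnvelope μ w D z ∂μ := by
    refine (integral_mono_ae hi henv hb).trans ?_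
    rw [integral_fun_snd]
    simp
  -- Under the product law the iterate can be frozen, and the noise at a fixed `θ` has mean zero.
  have hzero : ∫ q, f q ∂α.prod μ = 0 := by
    rw [integral_prod _ (hL'.integrable one_le_two)]
    refine integral_eq_zero_of_ae ?_
    filter_upwards [hα] with a ha
    simp only [hf, Pi.zero_apply]
    rw [integral_const_mul, integral_gradNoise hH hw hHw ha.1, mul_zero]
  have key := integral_comp_le_of_phiCoeff h𝓑 hε h hXs hY hY𝓐 hfm hL
    (by rw [hYμ]; exact hL') hκ (by rw [hYμ]; exact hκ')
  rw [hYμ, hzero, zero_add] at key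
  exact key

end Noise

/-! ### One step of the algorithm. -/

section Algebra

variable {𝒵 : Type*} {d : ℕ} {Θ : Set (EuclideanSpace ℝ (Fin d))}
  {θs : EuclideanSpace ℝ (Fin d)} {H : 𝒵 → EuclideanSpace ℝ (Fin d) → EuclideanSpace ℝ (Fin d)}
  {B : ℕ → ℕ}

theorem norm_miniGrad_sq_le {w : 𝒵 → ℝ} {z : ℕ → 𝒵} {I : Finset ℕ} {b : ℕ} (hb : 0 < b)
    (hI : I.card = b) {θ : EuclideanSpace ℝ (Fin d)}
    (hw : ∀ i ∈ I, ‖H (z i) θ‖ ^ 2 ≤ w (z i)) :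
    ‖miniGrad H b I z θ‖ ^ 2 ≤ 1 / (b : ℝ) * ∑ i ∈ I, w (z i) := by
  have hb' : (0 : ℝ) < b := by exact_mod_cast hb
  have h1 : ‖∑ i ∈ I, H (z i) θ‖ ^ 2 ≤ b * ∑ i ∈ I, w (z i) := by
    calc _ ≤ (∑ i ∈ I, ‖H (z i) θ‖) ^ 2 := pow_le_pow_left₀ (norm_nonneg _) (norm_sum_le _ _) 2
      _ ≤ I.card * ∑ i ∈ I, ‖H (z i) θ‖ ^ 2 := sq_sum_le_card_mul_sum_sq
      _ ≤ _ := by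
        rw [hI]
        exact mul_le_mul_of_nonneg_left (Finset.sum_le_sum hw) hb'.le
  rw [miniGrad, norm_smul, mul_pow, Real.norm_of_nonneg (by positivity)]
  calc _ ≤ (1 / (b : ℝ)) ^ 2 * (b * ∑ i ∈ I, w (z i)) :=
        mul_le_mul_of_nonneg_left h1 (by positivity)
    _ = _ := by field_simp

theorem sgd_mem (hΘ : IsCompact Θ) (hne : Θ.Nonempty) (η : ℕ → ℝ) (blk : ℕ → Finset ℕ)
    (θ₀ : EuclideanSpace ℝ (Fin d)) (z : ℕ → 𝒵) (t : ℕ) : sgd Θ H η B blk θ₀ z (t + 1) ∈ Θ :=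
  (projOn_spec hΘ hne _).1

theorem norm_sgd_succ_sub_sq_le (hΘ : IsCompact Θ) (hc : Convex ℝ Θ) (hs : θs ∈ Θ) (η : ℕ → ℝ)
    (blk : ℕ → Finset ℕ) (θ₀ : EuclideanSpace ℝ (Fin d)) (z : ℕ → 𝒵) (t : ℕ) :
    ‖sgd Θ H η B blk θ₀ z (t + 1) - θs‖ ^ 2 ≤ ‖sgd Θ H η B blk θ₀ z t - θs‖ ^ 2
      - 2 * η (t + 1) * inner ℝ (sgd Θ H η B blk θ₀ z t - θs)
        (miniGrad H (B (t + 1)) (blk (t + 1)) z (sgd Θ H η B blk θ₀ z t))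
      + η (t + 1) ^ 2 *
        ‖miniGrad H (B (t + 1)) (blk (t + 1)) z (sgd Θ H η B blk θ₀ z t)‖ ^ 2 := by
  rw [sgd]
  set θ := sgd Θ H η B blk θ₀ z t
  set G := miniGrad H (B (t + 1)) (blk (t + 1)) z θ
  refine (pow_le_pow_left₀ (norm_nonneg _) (norm_projOn_sub_le hΘ hc _ hs) 2).trans_eq ?_
  rw [show θ - η (t + 1) • G - θs = (θ - θs) - η (t + 1) • G by abel, norm_sub_sq_real,
    inner_smul_right, norm_smul, mul_pow, Real.norm_eq_abs, sq_abs]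
  ring

end Algebra

/-! ### Almost sure convergence of one trajectory. -/

section Convergence

variable {Ω 𝒵 : Type*} [mΩ : MeasurableSpace Ω] [MeasurableSpace 𝒵] {d : ℕ}
  {P : Measure Ω} {Z : ℕ → Ω → 𝒵}
  {Θ : Set (EuclideanSpace ℝ (Fin d))} {θs : EuclideanSpace ℝ (Fin d)}
  {l : 𝒵 → EuclideanSpace ℝ (Fin d) → ℝ}
  {H : 𝒵 → EuclideanSpace ℝ (Fin d) → EuclideanSpace ℝ (Fin d)}
  {M : 𝒵 → ℝ} {φ : ℕ → ℝ} {B : ℕ → ℕ} {p K δ γ ρ : ℝ}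

theorem LossAssumptions.exists_sq_envelope {μ : Measure 𝒵} [IsProbabilityMeasure μ]
    (hloss : LossAssumptions μ Θ θs l H M p K δ) :
    ∃ w : 𝒵 → ℝ, (∀ z, 0 ≤ w z) ∧ Integrable w μ ∧ ∀ᵐ z ∂μ, ∀ θ ∈ Θ, ‖H z θ‖ ^ 2 ≤ w z := by
  -- Since `p > 2`, `M² ≤ 1 + M^p` wherever `M ≥ 0`; the absolute value keeps the envelope
  -- nonnegative at every `z`.
  refine ⟨fun z => 1 + |M z ^ p|, fun z => by positivity,
    (integrable_const 1).add hloss.moment.abs, ?_⟩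
  filter_upwards [hloss.grad_le] with z hz θ hθ
  have hM : 0 ≤ M z := (norm_nonneg _).trans (hz θ hθ)
  refine (pow_le_pow_left₀ (norm_nonneg _) (hz θ hθ) 2).trans ?_
  rcases le_total (M z) 1 with h | h
  · exact (pow_le_one₀ hM h).trans (le_add_of_nonneg_right (abs_nonneg _))
  · have h1 : M z ^ 2 ≤ M z ^ p := by
      rw [← Real.rpow_natCast]
      exact Real.rpow_le_rpow_of_exponent_le h (by exact_mod_cast hloss.two_lt_p.le)
    linarith [le_abs_self (M z ^ p)]

theorem inner_miniGrad {μ : Measure 𝒵} {z : ℕ → 𝒵} {I : Finset ℕ} {b : ℕ} (hb : 0 < b)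
    (hI : I.card = b) (θ : EuclideanSpace ℝ (Fin d)) :
    inner ℝ (θ - θs) (miniGrad H b I z θ) = 1 / (b : ℝ) * ∑ i ∈ I, gradNoise μ H θs (θ, z i)
      + inner ℝ (θ - θs) (∫ z, H z θ ∂μ) := by
  have hb' : (b : ℝ) ≠ 0 := by exact_mod_cast hb.ne'
  simp only [gradNoise, miniGrad, inner_sub_right, Finset.sum_sub_distrib, Finset.sum_const, hI,
    inner_smul_right, inner_sum, nsmul_eq_mul]
  field_simp
  ring

/-- Almost sure convergence of projected mini-batch SGD when block `t` ends by time `n t` and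
block `t + 1` starts at least `B t` steps later. -/
theorem ae_tendsto_sgd [IsProbabilityMeasure P]
    (hdata : DataAssumptions P Z φ (fun z => H z θs))
    (hloss : LossAssumptions (P.map (Z 1)) Θ θs l H M p K δ)
    (hrate : RateAssumptions φ B p γ ρ) {blk : ℕ → Finset ℕ} {n : ℕ → ℕ}
    (hn : ∀ t, 1 ≤ t → n t ≤ n (t + 1)) (hn1 : ∀ t, 1 ≤ t → 1 ≤ n t)
    (hblk : ∀ t, 1 ≤ t → ∀ i ∈ blk t, 1 ≤ i ∧ i ≤ n t)
    (hgap : ∀ t, 1 ≤ t → ∀ i ∈ blk (t + 1), n t + B t ≤ i)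
    (hcard : ∀ t, 1 ≤ t → (blk t).card = B t) (θ₀ : EuclideanSpace ℝ (Fin d)) :
    ∀ᵐ ω ∂P, Tendsto (sgd Θ H (learningRate γ ρ) B blk θ₀ (fun i => Z i ω)) atTop (𝓝 θs) := by
  have hZ := hdata.measurable
  set μ := P.map (Z 1) with hμ
  have : IsProbabilityMeasure μ := Measure.isProbabilityMeasure_map (hZ 1 le_rfl).aemeasurable
  have hlaw : ∀ i, 1 ≤ i → P.map (Z i) = μ := fun i hi => hdata.stationary.map_eq hZ hi
  obtain ⟨w, hw0, hw, hHw⟩ := hloss.exists_sq_envelope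
  obtain ⟨m, hm, hconv⟩ := hloss.strongConvex
  have hc : Convex ℝ Θ := hconv.1
  have hΘ := hloss.compact
  have hs : θs ∈ Θ := interior_subset hloss.mem_interior
  have hne : Θ.Nonempty := ⟨θs, hs⟩
  have hH := hloss.measurable_grad
  have hproj := measurable_projOn hΘ hc hne
  obtain ⟨D, hD⟩ : ∃ D, ∀ θ ∈ Θ, ‖θ - θs‖ ≤ D := by
    obtain ⟨D, hD⟩ := hΘ.isBounded.subset_closedBall θs
    exact ⟨D, fun θ hθ => by simpa [dist_eq_norm] using hD hθ⟩
  have hdrift : ∀ θ ∈ Θ, m / 4 * ‖θ - θs‖ ^ 2 ≤ inner ℝ (θ - θs) (∫ z, H z θ ∂μ) := by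
    intro θ hθ
    rw [hloss.unbiased θ hθ, real_inner_comm]
    exact inner_gradientWithin_ge_of_strongConvexOn hconv hm.le hs hloss.argmin hθ
      ((hloss.contDiff.differentiableOn one_ne_zero) θ hθ)
  set η : ℕ → ℝ := learningRate γ ρ with hη
  have hη0 : ∀ t, 0 < η t := learningRate_pos hrate.γ_pos
  have hBpos : ∀ k, 0 < B (k + 2) := fun k => hrate.batch_pos _ (by omega)
  have hBpos' : ∀ k, (0 : ℝ) < B (k + 2) := fun k => by exact_mod_cast hBpos k
  have hcard' : ∀ k, (blk (k + 2)).card = B (k + 2) := fun k => hcard _ (by omega)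
  have hi1 : ∀ k, ∀ i ∈ blk (k + 2), 1 ≤ i := fun k i hi => (hblk _ (by omega) i hi).1
  -- The index is shifted by one because the initial value may lie outside `Θ`; from the first
  -- projection on, all iterates are in `Θ`. The next update uses `η (k + 2)` and block `k + 2`.
  set X : ℕ → Ω → EuclideanSpace ℝ (Fin d) :=
    fun k ω => sgd Θ H η B blk θ₀ (fun i => Z i ω) (k + 1) with hX
  have hXΘ : ∀ k ω, X k ω ∈ Θ := fun k ω => sgd_mem hΘ hne _ _ _ _ _
  have hnmono : Monotone fun k => n (k + 1) := monotone_nat_of_le_succ fun k => hn _ (by omega)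
  -- `ℱ k` contains the data up to the end of block `k + 1`, the last block that `X k` uses.
  let ℱ : Filtration ℕ mΩ :=
    { seq := fun k => sigmaGen Z (Icc 1 (n (k + 1)))
      mono' := fun a b hab => sigmaGen_mono Z (Icc_subset_Icc_right (hnmono hab))
      le' := fun k => iSup₂_le fun i hi => (hZ i hi.1).comap_le }
  have hZℱ : ∀ t k, 1 ≤ t → t ≤ k + 1 → ∀ i ∈ blk t, Measurable[ℱ k] (Z i) := by
    intro t k ht htk i hi
    refine measurable_sigmaGen Z ⟨(hblk t ht i hi).1, (hblk t ht i hi).2.trans ?_⟩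
    obtain ⟨s, rfl⟩ := Nat.exists_eq_add_of_le' ht
    exact hnmono (by omega : s ≤ k)
  have hXℱ : ∀ k, Measurable[ℱ k] (X k) := fun k =>
    measurable_sgd (mΩ := ℱ k) hH hproj η B blk θ₀ (k + 1)
      fun t h1 h2 => hZℱ t k h1 h2
  have hXm : ∀ k, Measurable (X k) := fun k => (hXℱ k).mono (ℱ.le k) le_rfl
  set N : ℕ → ℕ → Ω → ℝ := fun k i ω => gradNoise μ H θs (X k ω, Z i ω) with hN
  set κ : ℝ := ∫ z, noiseEnvelope μ w D z ∂μ with hκ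
  have hNL : ∀ k, ∀ i ∈ blk (k + 2), MemLp (N k i) 2 P ∧ ∫ ω, N k i ω ^ 2 ∂P ≤ κ := by
    intro k i hi
    simpa using memLp_gradNoise_comp (s := fun _ => 1) hH hw hHw hD (hXm k) (hZ i (hi1 k i hi))
      (hXΘ k) (hlaw i (hi1 k i hi)) measurable_const (by simp)
  set x : ℕ → Ω → ℝ :=
    fun k ω => -(2 * η (k + 2) * (1 / (B (k + 2) : ℝ))) * ∑ i ∈ blk (k + 2), N k i ω with hx
  have hxm : ∀ k, StronglyMeasurable[ℱ (k + 1)] (x k) := by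
    intro k
    have hX' : Measurable[ℱ (k + 1)] (X k) := (hXℱ k).mono (ℱ.mono (Nat.le_succ k)) le_rfl
    have hsum : Measurable[ℱ (k + 1)] fun ω => ∑ i ∈ blk (k + 2), N k i ω :=
      Finset.measurable_fun_sum _ fun i hi => (measurable_gradNoise hH μ θs).comp
        (hX'.prodMk (hZℱ (k + 2) (k + 1) (by omega) le_rfl i hi))
    exact (hsum.const_mul _).stronglyMeasurable
  have hxL : ∀ k, MemLp (x k) 2 P := fun k =>
    (memLp_finsetSum _ fun i hi => (hNL k i hi).1).const_mul _
  -- No cancellation inside a batch is needed: Cauchy–Schwarz bounds the averaged noise uniformly in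
  -- the batch size, and `∑ η² < ∞` suffices.
  have hxsq : ∀ k, ∫ ω, x k ω ^ 2 ∂P ≤ 4 * κ * η (k + 2) ^ 2 := by
    intro k
    have hb := hBpos' k
    have hle : ∀ ω, x k ω ^ 2 ≤
        (2 * η (k + 2)) ^ 2 * (1 / (B (k + 2) : ℝ)) * ∑ i ∈ blk (k + 2), N k i ω ^ 2 := by
      intro ω
      have h1 : (∑ i ∈ blk (k + 2), N k i ω) ^ 2
          ≤ (blk (k + 2)).card * ∑ i ∈ blk (k + 2), N k i ω ^ 2 := sq_sum_le_card_mul_sum_sq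
      rw [hcard'] at h1
      calc x k ω ^ 2 = (2 * η (k + 2) * (1 / (B (k + 2) : ℝ))) ^ 2
            * (∑ i ∈ blk (k + 2), N k i ω) ^ 2 := by simp only [hx]; ring
        _ ≤ (2 * η (k + 2) * (1 / (B (k + 2) : ℝ))) ^ 2
            * (B (k + 2) * ∑ i ∈ blk (k + 2), N k i ω ^ 2) :=
            mul_le_mul_of_nonneg_left h1 (sq_nonneg _)
        _ = _ := by field_simp
    have hint : Integrable (fun ω => ∑ i ∈ blk (k + 2), N k i ω ^ 2) P :=
      integrable_finsetSum _ fun i hi => (hNL k i hi).1.integrable_sq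
    refine (integral_mono (hxL k).integrable_sq (hint.const_mul _) hle).trans ?_
    rw [integral_const_mul, integral_finsetSum _ fun i hi => (hNL k i hi).1.integrable_sq]
    have h2 : ∑ i ∈ blk (k + 2), ∫ ω, N k i ω ^ 2 ∂P ≤ B (k + 2) * κ := by
      have := Finset.sum_le_card_nsmul (blk (k + 2)) _ κ fun i hi => (hNL k i hi).2
      rwa [hcard', nsmul_eq_mul] at this
    calc _ ≤ (2 * η (k + 2)) ^ 2 * (1 / (B (k + 2) : ℝ)) * (B (k + 2) * κ) :=
          mul_le_mul_of_nonneg_left h2 (by positivity)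
      _ = _ := by field_simp; ring
  have hxb : ∀ k, ∫ ω, |(P[x k|ℱ k]) ω| ∂P
      ≤ 2 * (2 + 2 * κ) * (η (k + 2) * √(φ (B (k + 1)))) := by
    intro k
    have hb := hBpos' k
    refine integral_abs_condExp_le_of_forall (ℱ.le k) ((hxL k).integrable one_le_two)
      fun s hsm hs1 => ?_
    have hB1 : 1 ≤ B (k + 1) := hrate.batch_pos _ (by omega)
    have hφ : 0 ≤ φ (B (k + 1)) :=
      nonneg_of_antitoneOn_tendsto_zero hdata.antitone hdata.tendsto_zero hB1
    have hmix : phiCoeff P (ℱ k) (sigmaGen Z (Ici (n (k + 1) + B (k + 1))))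
        ≤ ENNReal.ofReal (φ (B (k + 1))) :=
      (le_iSup₂_of_le (n (k + 1)) (hn1 _ (by omega)) le_rfl).trans (hdata.mixing_le _ hB1)
    -- The minus sign in `x` is absorbed into the test function, `-s` being as admissible as `s`.
    have hterm : ∀ i ∈ blk (k + 2),
        ∫ ω, -s ω * N k i ω ∂P ≤ (2 + 2 * κ) * √(φ (B (k + 1))) := fun i hi =>
      integral_mul_gradNoise_le (ℱ.le k) hH hΘ.isClosed.measurableSet hw hHw hD hφ hmix (hXℱ k)
        (hZ i (hi1 k i hi)) (measurable_sigmaGen Z (hgap (k + 1) (by omega) i hi)).comap_le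
        (hXΘ k) (hlaw i (hi1 k i hi)) hsm.neg (fun ω => by simpa using hs1 ω)
    have hsi : ∀ i ∈ blk (k + 2), Integrable (fun ω => -s ω * N k i ω) P := fun i hi =>
      ((hNL k i hi).1.integrable one_le_two).bdd_mul (c := 1)
        (hsm.neg.mono (ℱ.le k) le_rfl).aestronglyMeasurable
        (ae_of_all _ fun ω => by simpa using hs1 ω)
    have heq : ∀ ω, s ω * x k ω = 2 * η (k + 2) * (1 / (B (k + 2) : ℝ))
        * ∑ i ∈ blk (k + 2), -s ω * N k i ω := by
      intro ω
      rw [← Finset.mul_sum]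
      simp only [hx]
      ring
    simp_rw [heq]
    rw [integral_const_mul, integral_finsetSum _ hsi]
    have h2 : ∑ i ∈ blk (k + 2), ∫ ω, -s ω * N k i ω ∂P
        ≤ B (k + 2) * ((2 + 2 * κ) * √(φ (B (k + 1)))) := by
      have := Finset.sum_le_card_nsmul (blk (k + 2)) _ _ hterm
      rwa [hcard', nsmul_eq_mul] at this
    have hη' := hη0 (k + 2)
    calc _ ≤ 2 * η (k + 2) * (1 / (B (k + 2) : ℝ))
          * (B (k + 2) * ((2 + 2 * κ) * √(φ (B (k + 1))))) :=
          mul_le_mul_of_nonneg_left h2 (by positivity)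
      _ = _ := by field_simp
  have hη2 : Summable fun k => η (k + 2) ^ 2 :=
    summable_learningRate_sq hrate.γ_pos hrate.half_lt_ρ
  have hconvx := ae_exists_tendsto_sum ℱ hxm hxL
    (Summable.of_nonneg_of_le (fun k => integral_nonneg fun ω => sq_nonneg _) hxsq
      (hη2.mul_left _))
    (Summable.of_nonneg_of_le (fun k => integral_nonneg fun ω => abs_nonneg _) hxb
      ((hrate.summable_learningRate_mul_sqrt hloss.two_lt_p hdata.antitone
        hdata.tendsto_zero).mul_left _))
  -- An upper bound for the quadratic term of the step, with expectation a constant times `η (k + 2)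
  -- ^ 2`.
  set q : ℕ → Ω → ℝ :=
    fun k ω => η (k + 2) ^ 2 * (1 / (B (k + 2) : ℝ) * ∑ i ∈ blk (k + 2), w (Z i ω)) with hq
  have hwi : ∀ i, 1 ≤ i → Integrable (fun ω => w (Z i ω)) P ∧ ∫ ω, w (Z i ω) ∂P = ∫ z, w z ∂μ := by
    intro i hi
    have h1 : Integrable w (P.map (Z i)) := by rwa [hlaw i hi]
    refine ⟨h1.comp_measurable (hZ i hi), ?_⟩
    rw [← integral_map (hZ i hi).aemeasurable h1.aestronglyMeasurable, hlaw i hi]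
  have hqi : ∀ k, Integrable (q k) P := fun k =>
    ((integrable_finsetSum _ fun i hi => (hwi i (hi1 k i hi)).1).const_mul _).const_mul _
  have hqint : ∀ k, ∫ ω, q k ω ∂P = η (k + 2) ^ 2 * ∫ z, w z ∂μ := by
    intro k
    have hb := hBpos' k
    simp only [hq]
    rw [integral_const_mul, integral_const_mul,
      integral_finsetSum _ fun i hi => (hwi i (hi1 k i hi)).1,
      Finset.sum_congr rfl fun i hi => (hwi i (hi1 k i hi)).2, Finset.sum_const, hcard',
      nsmul_eq_mul]
    field_simp
  have hconvq := ae_summable_of_summable_integral (P := P) (f := q)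
    (fun k ω => mul_nonneg (sq_nonneg _) (mul_nonneg (by positivity)
      (Finset.sum_nonneg fun i _ => hw0 _))) hqi (by simp_rw [hqint]; exact hη2.mul_right _)
  have hbound : ∀ᵐ ω ∂P, ∀ i, 1 ≤ i → ∀ θ ∈ Θ, ‖H (Z i ω) θ‖ ^ 2 ≤ w (Z i ω) := by
    refine ae_all_iff.2 fun i => ?_
    by_cases hi : 1 ≤ i
    · have h : ∀ᵐ z ∂P.map (Z i), ∀ θ ∈ Θ, ‖H z θ‖ ^ 2 ≤ w z := by rwa [hlaw i hi]
      filter_upwards [ae_of_ae_map (hZ i hi).aemeasurable h] with ω hω _ using hω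
    · exact ae_of_all _ fun ω h => absurd h hi
  filter_upwards [hconvx, hconvq, hbound] with ω ⟨c, hcx⟩ hqω hω
  have hV : Tendsto (fun k => ‖X k ω - θs‖ ^ 2) atTop (𝓝 0) := by
    -- The rate `m / 2` is the factor `2` of the cross term times the drift constant `m / 4`.
    refine tendsto_zero_of_recursive_le (a := fun k => m / 2 * η (k + 2))
      (e := fun k => x k ω + q k ω) (c := c + ∑' k, q k ω) (fun k => sq_nonneg _)
      (fun k => mul_nonneg (by linarith) (hη0 _).le) (fun k => ?_) ?_ ?_
    · have h1 := norm_sgd_succ_sub_sq_le (H := H) (B := B) hΘ hc hs η blk θ₀ (fun i => Z i ω)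
        (k + 1)
      change ‖X (k + 1) ω - θs‖ ^ 2 ≤ ‖X k ω - θs‖ ^ 2 - 2 * η (k + 2) *
        inner ℝ (X k ω - θs) (miniGrad H (B (k + 2)) (blk (k + 2)) (fun i => Z i ω) (X k ω))
        + η (k + 2) ^ 2 *
          ‖miniGrad H (B (k + 2)) (blk (k + 2)) (fun i => Z i ω) (X k ω)‖ ^ 2 at h1
      rw [inner_miniGrad (μ := μ) (hBpos k) (hcard' k)] at h1
      have h2 := mul_le_mul_of_nonneg_left (norm_miniGrad_sq_le (H := H) (w := w)
        (z := fun i => Z i ω) (hBpos k) (hcard' k)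
        fun i hi => hω i (hi1 k i hi) _ (hXΘ k ω)) (sq_nonneg (η (k + 2)))
      have h3 := mul_le_mul_of_nonneg_left (hdrift _ (hXΘ k ω)) (hη0 (k + 2)).le
      simp only [hx, hq, hN]
      linarith
    · simp_rw [Finset.sum_add_distrib]
      exact hcx.add hqω.hasSum.tendsto_sum_nat
    · rw [summable_mul_left_iff (by positivity)]
      exact not_summable_learningRate hrate.γ_pos (by linarith [hrate.half_lt_ρ]) hrate.ρ_lt_one
  rw [← tendsto_add_atTop_iff_nat 1, tendsto_iff_norm_sub_tendsto_zero]
  have := hV.sqrt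
  simpa [Real.sqrt_sq] using this

end Convergence

/-! ### Block arithmetic and averaging. -/

section Blocks

theorem sum_Ico_one_succ (B : ℕ → ℕ) {t : ℕ} (ht : 1 ≤ t) :
    ∑ i ∈ Finset.Ico 1 (t + 1), B i = ∑ i ∈ Finset.Ico 1 t, B i + B t :=
  Finset.sum_Ico_succ_top ht B

theorem blockJ_eq (B : ℕ → ℕ) {t : ℕ} (ht : 1 ≤ t) :
    blockJ B t = Finset.Icc (2 * (∑ i ∈ Finset.Ico 1 t, B i) + B t + 1)
      (2 * (∑ i ∈ Finset.Ico 1 t, B i) + 2 * B t) := by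
  have : Finset.Icc 1 t = Finset.Ico 1 (t + 1) := by ext; simp
  rw [blockJ, this, sum_Ico_one_succ B ht, mul_add]

theorem tendsto_polyakRuppert {d : ℕ} {a b : ℕ → EuclideanSpace ℝ (Fin d)}
    {θ : EuclideanSpace ℝ (Fin d)} (ha : Tendsto a atTop (𝓝 θ)) (hb : Tendsto b atTop (𝓝 θ)) :
    Tendsto (polyakRuppert a b) atTop (𝓝 θ) := by
  -- The average over `1, …, T` is a Cesàro mean of the shifted sequence of midpoints.
  have h1 : Tendsto (fun i => (1 / 2 : ℝ) • (a (i + 1) + b (i + 1))) atTop (𝓝 θ) := by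
    have := ((ha.add hb).comp (tendsto_add_atTop_nat 1)).const_smul (1 / 2 : ℝ)
    rwa [← two_smul ℝ θ, smul_smul, one_div_mul_cancel two_ne_zero, one_smul] at this
  refine h1.cesaro_smul.congr fun T => ?_
  rw [polyakRuppert, ← Finset.smul_sum, smul_smul, Finset.range_eq_Ico,
    Finset.sum_Ico_add' (fun i => a i + b i) 0 T 1]
  congr 1
  rw [one_div, one_div, mul_inv, mul_comm]

end Blocks

end PhiSGD
open PhiSGD
theorem theorem1 {Ω 𝒵 : Type*} [MeasurableSpace Ω] [MeasurableSpace 𝒵] {d : ℕ}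
    (P : Measure Ω) [IsProbabilityMeasure P] (Z : ℕ → Ω → 𝒵)
    (Θ : Set (EuclideanSpace ℝ (Fin d))) (θs : EuclideanSpace ℝ (Fin d))
    (l : 𝒵 → EuclideanSpace ℝ (Fin d) → ℝ)
    (H : 𝒵 → EuclideanSpace ℝ (Fin d) → EuclideanSpace ℝ (Fin d))
    (M : 𝒵 → ℝ) (φ : ℕ → ℝ) (B : ℕ → ℕ) (p K δ γ ρ : ℝ)
    (hdata : DataAssumptions P Z φ (fun z => H z θs))
    (hloss : LossAssumptions (P.map (Z 1)) Θ θs l H M p K δ)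
    (hrate : RateAssumptions φ B p γ ρ)
    (θa₀ θb₀ : EuclideanSpace ℝ (Fin d)) :
    ∀ᵐ ω ∂P,
      Tendsto (sgd Θ H (learningRate γ ρ) B (blockI B) θa₀ (fun i => Z i ω)) atTop (𝓝 θs) ∧
      Tendsto (sgd Θ H (learningRate γ ρ) B (blockJ B) θb₀ (fun i => Z i ω)) atTop (𝓝 θs) ∧
      Tendsto (polyakRuppert
        (sgd Θ H (learningRate γ ρ) B (blockI B) θa₀ (fun i => Z i ω))
        (sgd Θ H (learningRate γ ρ) B (blockJ B) θb₀ (fun i => Z i ω))) atTop (𝓝 θs) := by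
  have hI : ∀ᵐ ω ∂P, Tendsto (sgd Θ H (learningRate γ ρ) B (blockI B) θa₀ (fun i => Z i ω))
      atTop (𝓝 θs) := by
    -- `n t` is the last index of `I_t`; the skipped block `J_t` supplies the gap `B t`.
    refine ae_tendsto_sgd hdata hloss hrate
      (n := fun t => 2 * (∑ i ∈ Finset.Ico 1 t, B i) + B t) (fun t ht => ?_) (fun t ht => ?_)
      (fun t ht i hi => ?_) (fun t ht i hi => ?_) (fun t ht => ?_) θa₀
    · simp only [sum_Ico_one_succ B ht]; omega
    · have := hrate.batch_pos t ht; omega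
    · simp only [blockI, Finset.mem_Icc] at hi; omega
    · simp only [blockI, Finset.mem_Icc, sum_Ico_one_succ B ht] at hi; omega
    · simp [blockI]
  have hJ : ∀ᵐ ω ∂P, Tendsto (sgd Θ H (learningRate γ ρ) B (blockJ B) θb₀ (fun i => Z i ω))
      atTop (𝓝 θs) := by
    -- Here the skipped block is `I_{t+1}`, of length `B (t + 1)`; monotonicity of `B` makes it at
    -- least `B t`.
    refine ae_tendsto_sgd hdata hloss hrate
      (n := fun t => 2 * (∑ i ∈ Finset.Ico 1 t, B i) + 2 * B t) (fun t ht => ?_) (fun t ht => ?_)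
      (fun t ht i hi => ?_) (fun t ht i hi => ?_) (fun t ht => ?_) θb₀
    · simp only [sum_Ico_one_succ B ht]; omega
    · have := hrate.batch_pos t ht; omega
    · simp only [blockJ_eq B ht, Finset.mem_Icc] at hi; omega
    · have hle : B t ≤ B (t + 1) :=
        hrate.batch_mono ht (mem_Ici.2 (by omega)) (Nat.le_succ t)
      simp only [blockJ_eq B (Nat.le_add_left 1 t), Finset.mem_Icc, sum_Ico_one_succ B ht] at hi
      omega
    · rw [blockJ_eq B ht, Nat.card_Icc]; omega
  filter_upwards [hI, hJ] with ω hI hJ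
  exact ⟨hI, hJ, tendsto_polyakRuppert hI hJ⟩
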